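/- Let $d \in \mathbb{N}$ and $0 < T < \infty$. Let $a = (a_{ij})_{1\le i,j\le d}$ be a measurable, symmetric-matrix-valued function on $\mathbb{R}^d$ whose entries are bounded by a constant, and assume **(E)** there is $\lambda \in (0,\infty)$ such that $\lambda|\xi|^2 \le \xi^* a(x)\xi$ for all $x,\xi \in \mathbb{R}^d$. Let $A$ be the unbounded operator on the real space $L^2(\mathbb{R}^d)$ given by $$\mathcal{D}(A) = \Big\{u \in H^1(\mathbb{R}^d) : \sum_{i,j=1}^d D_i(a_{ij}D_j u) \in L^2(\mathbb{R}^d)\Big\}, \qquad Au = \sum_{i,j=1}^d D_i(a_{ij}D_j u),$$ where $D_i$ is the derivative in the sense of distributions. Put $\mathcal{D}(A^0) = L^2(\mathbb{R}^d)$, $\mathcal{D}(A^1) = \mathcal{D}(A)$ and $\mathcal{D}(A^k) = \{v \in \mathcal{D}(A^{k-1}) : Av \in \mathcal{D}(A^{k-1})\}$ for $k \ge 2$; each $\mathcal{D}(A^k)$ carries the graph norm $\|v\|_{\mathcal{D}(A^k)} = \big(\sum_{i=0}^k \|A^i v\|_{L^2(\mathbb{R}^d)}^2\big)^{1/2}$.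 **Proposition 3.14.** Let $u_0 \in \mathcal{D}(A)$. Then there exists a unique function $u \in C^1([0,T]; L^2(\mathbb{R}^d)) \cap C([0,T]; \mathcal{D}(A))$ such that $$\frac{du}{dt}(t) = Au(t) \quad (0 \le t \le T), \qquad u(0) = u_0,$$ where the time derivative is the strong one in $L^2(\mathbb{R}^d)$ (one-sided at $t = 0$ and $t = T$). If moreover $u_0 \in \mathcal{D}(A^k)$ for some integer $k \ge 2$, then $$u \in C^{k-j}([0,T]; \mathcal{D}(A^j)) \quad \text{for all } 0 \le j \le k.$$ -/

import Mathlib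

open MeasureTheory Set
open scoped ContDiff

noncomputable section

/-! ### Powers of an unbounded operator and their graph norms -/

namespace LinearPMap

variable {H : Type*} [NormedAddCommGroup H] [NormedSpace ℝ H]

/-- Given an unbounded operator `A` and a subspace `S`, the subspace of all `v ∈ S` that lie in the
domain of `A` and satisfy `A v ∈ S`. -/
def domainStep (A : H →ₗ.[ℝ] H) (S : Submodule ℝ H) : Submodule ℝ H where
  carrier := {v | v ∈ S ∧ ∃ h : v ∈ A.domain, A ⟨v, h⟩ ∈ S}
  zero_mem' := by
    refine ⟨S.zero_mem, A.domain.zero_mem, ?_⟩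
    have h : A (0 : A.domain) = 0 := A.map_zero
    change A (0 : A.domain) ∈ S
    rw [h]
    exact S.zero_mem
  add_mem' := by
    rintro v w ⟨hv, hv', hAv⟩ ⟨hw, hw', hAw⟩
    refine ⟨S.add_mem hv hw, A.domain.add_mem hv' hw', ?_⟩
    have h := A.map_add ⟨v, hv'⟩ ⟨w, hw'⟩
    change A (⟨v, hv'⟩ + ⟨w, hw'⟩ : A.domain) ∈ S
    rw [h]
    exact S.add_mem hAv hAw
  smul_mem' := by
    rintro c v ⟨hv, hv', hAv⟩
    refine ⟨S.smul_mem c hv, A.domain.smul_mem c hv', ?_⟩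
    have h := A.map_smul c ⟨v, hv'⟩
    change A (c • ⟨v, hv'⟩ : A.domain) ∈ S
    rw [h]
    exact S.smul_mem c hAv

/-- The iterated domains: `D(A⁰)` is the whole space and
`D(Aᵏ⁺¹) = {v ∈ D(Aᵏ) : A v ∈ D(Aᵏ)}`; in particular `D(A¹) = D(A)`, see `powDomain_one`. -/
def powDomain (A : H →ₗ.[ℝ] H) : ℕ → Submodule ℝ H
  | 0 => ⊤
  | k + 1 => A.domainStep (A.powDomain k)

theorem powDomain_one (A : H →ₗ.[ℝ] H) : A.powDomain 1 = A.domain := by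
  ext v
  constructor
  · rintro ⟨-, h, -⟩
    exact h
  · intro h
    exact ⟨Submodule.mem_top, h, Submodule.mem_top⟩

theorem powDomain_antitone (A : H →ₗ.[ℝ] H) : Antitone A.powDomain :=
  antitone_nat_of_succ_le fun _ _ hv => hv.1

/-- The operator `A` as a linear map `D(Aᵏ⁺¹) → D(Aᵏ)`. -/
def powStep (A : H →ₗ.[ℝ] H) (k : ℕ) : A.powDomain (k + 1) →ₗ[ℝ] A.powDomain k where
  toFun v := ⟨A ⟨v.1, v.2.2.choose⟩, v.2.2.choose_spec⟩
  map_add' v w := Subtype.ext (A.map_add ⟨v.1, v.2.2.choose⟩ ⟨w.1, w.2.2.choose⟩)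
  map_smul' c v := Subtype.ext (A.map_smul c ⟨v.1, v.2.2.choose⟩)

/-- The power `Aᵏ` as a linear map `D(Aᵏ) → H`. -/
def powMap (A : H →ₗ.[ℝ] H) : (k : ℕ) → A.powDomain k →ₗ[ℝ] H
  | 0 => (A.powDomain 0).subtype
  | k + 1 => A.powMap k ∘ₗ A.powStep k

/-- The space `D(Aᵏ)`, as a type of its own; it carries the graph norm below, not the norm of
`H`. -/
def PowDom (A : H →ₗ.[ℝ] H) (k : ℕ) : Type _ := A.powDomain k

namespace PowDom

variable (A : H →ₗ.[ℝ] H) (k : ℕ)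

instance : AddCommGroup (PowDom A k) := inferInstanceAs (AddCommGroup (A.powDomain k))

instance : Module ℝ (PowDom A k) := inferInstanceAs (Module ℝ (A.powDomain k))

/-- The inclusion of `D(Aᵏ)` in `H`. -/
def incl : PowDom A k →ₗ[ℝ] H := (A.powDomain k).subtype

/-- The map `v ↦ (v, A v, …, Aᵏ v)` from `D(Aᵏ)` to the Hilbert sum of `k + 1` copies of `H`. -/
def orbit : PowDom A k →ₗ[ℝ] PiLp 2 (fun _ : Fin (k + 1) => H) :=
  (WithLp.linearEquiv 2 ℝ (Fin (k + 1) → H)).symm.toLinearMap ∘ₗ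
    LinearMap.pi fun i : Fin (k + 1) =>
      A.powMap i ∘ₗ Submodule.inclusion (A.powDomain_antitone (Nat.le_of_lt_succ i.2))

theorem orbit_injective : Function.Injective (orbit A k) := by
  intro v w h
  exact Subtype.ext (congrArg (fun z : PiLp 2 (fun _ : Fin (k + 1) => H) => z 0) h)

/-- The graph norm `‖v‖ = (‖v‖² + ‖A v‖² + ⋯ + ‖Aᵏ v‖²)^(1/2)` on `D(Aᵏ)`. -/
instance : NormedAddCommGroup (PowDom A k) :=
  NormedAddCommGroup.induced (PowDom A k) (PiLp 2 (fun _ : Fin (k + 1) => H)) (orbit A k)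
    (orbit_injective A k)

instance : NormedSpace ℝ (PowDom A k) :=
  NormedSpace.induced ℝ (PowDom A k) (PiLp 2 (fun _ : Fin (k + 1) => H)) (orbit A k)

theorem norm_eq (v : PowDom A k) :
    ‖v‖ = √(∑ i : Fin (k + 1),
      ‖A.powMap i (Submodule.inclusion (A.powDomain_antitone (Nat.le_of_lt_succ i.2)) v)‖ ^ 2) :=
  PiLp.norm_eq_of_L2 (orbit A k v)

end PowDom

/-- `u ∈ Cᵐ([0, T]; D(Aʲ))`: on `[0, T]` the function `u` takes its values in `D(Aʲ)`, and it is
`m` times continuously differentiable (one-sidedly at the end points) as a map into the normed space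
`D(Aʲ)`. Values of `u` outside `[0, T]` play no role. -/
def MemCPowDom (A : H →ₗ.[ℝ] H) (T : ℝ) (m j : ℕ) (u : ℝ → H) : Prop :=
  ∃ w : ℝ → PowDom A j, ContDiffOn ℝ m w (Icc 0 T) ∧ ∀ t ∈ Icc 0 T, PowDom.incl A j (w t) = u t

/-- `u ∈ C¹([0, T]; H) ∩ C([0, T]; D(A))`, `du/dt = A u` on `[0, T]` and `u(0) = u₀`. -/
structure IsStrongSolution (A : H →ₗ.[ℝ] H) (T : ℝ) (u₀ : H) (u : ℝ → H) : Prop where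
  contDiffOn : ContDiffOn ℝ 1 u (Icc 0 T)
  memC : A.MemCPowDom T 0 1 u
  hasDeriv : ∀ t ∈ Icc 0 T,
    ∃ h : u t ∈ A.domain, HasDerivWithinAt u (A ⟨u t, h⟩) (Icc 0 T) t
  initial : u 0 = u₀

end LinearPMap

/-! ### The divergence form operator on `L²(ℝᵈ)` -/

/-- The real Hilbert space `L²(ℝᵈ)`. -/
abbrev L2 (d : ℕ) : Type :=
  Lp ℝ 2 (volume : Measure (EuclideanSpace ℝ (Fin d)))

/-- Test functions: `φ ∈ C_c^∞(ℝᵈ; ℝ)`. -/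
def IsTest {d : ℕ} (φ : EuclideanSpace ℝ (Fin d) → ℝ) : Prop :=
  ContDiff ℝ ∞ φ ∧ HasCompactSupport φ

/-- The classical partial derivative of `φ` with respect to the `i`-th coordinate. -/
def pderiv {d : ℕ} (i : Fin d) (φ : EuclideanSpace ℝ (Fin d) → ℝ)
    (x : EuclideanSpace ℝ (Fin d)) : ℝ :=
  fderiv ℝ φ x (EuclideanSpace.single i 1)

/-- A symmetric matrix-valued coefficient on `ℝᵈ` with (Lebesgue) measurable entries, bounded by a
constant. -/
structure DiffusionMatrix (d : ℕ) where
  /-- The matrix `a(x)`. -/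
  coeff : EuclideanSpace ℝ (Fin d) → Matrix (Fin d) (Fin d) ℝ
  symm : ∀ x, (coeff x).IsSymm
  measurable : ∀ i j, AEMeasurable (fun x => coeff x i j)
  bounded : ∃ Λ : ℝ, ∀ x i j, |coeff x i j| ≤ Λ

section Helpers

variable {d : ℕ}

theorem IsTest.continuous {φ : EuclideanSpace ℝ (Fin d) → ℝ} (h : IsTest φ) : Continuous φ :=
  h.1.continuous

theorem IsTest.memLp {φ : EuclideanSpace ℝ (Fin d) → ℝ} (h : IsTest φ) : MemLp φ 2 volume :=
  h.continuous.memLp_of_hasCompactSupport h.2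

theorem IsTest.memLp_pderiv {φ : EuclideanSpace ℝ (Fin d) → ℝ} (h : IsTest φ) (i : Fin d) :
    MemLp (pderiv i φ) 2 volume :=
  Continuous.memLp_of_hasCompactSupport
    ((h.1.continuous_fderiv (by simp)).clm_apply continuous_const) (h.2.fderiv_apply (𝕜 := ℝ) _)

theorem L2.integrable_mul (u : L2 d) {ψ : EuclideanSpace ℝ (Fin d) → ℝ}
    (h : MemLp ψ 2 volume) : Integrable (fun x => u x * ψ x) :=
  (Lp.memLp u).integrable_mul h

theorem DiffusionMatrix.integrable (a : DiffusionMatrix d) (u : L2 d)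
    {ψ : EuclideanSpace ℝ (Fin d) → ℝ} (h : MemLp ψ 2 volume) (i j : Fin d) :
    Integrable (fun x => a.coeff x i j * u x * ψ x) := by
  obtain ⟨C, hC⟩ := a.bounded
  have := (L2.integrable_mul u h).bdd_mul (a.measurable i j).aestronglyMeasurable
    (c := C) (Filter.Eventually.of_forall fun x => hC x i j)
  simpa only [mul_assoc] using this

theorem L2.eq_zero_of_test (f : L2 d)
    (h : ∀ φ : EuclideanSpace ℝ (Fin d) → ℝ, IsTest φ → ∫ x, f x * φ x = 0) : f = 0 := by
  rw [Lp.eq_zero_iff_ae_eq_zero]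
  refine ae_eq_zero_of_integral_contDiff_smul_eq_zero
    ((Lp.memLp f).locallyIntegrable (by norm_num)) fun φ h1 h2 => ?_
  simpa only [smul_eq_mul, mul_comm] using h φ ⟨h1, h2⟩

end Helpers

/-- The graph of the weak derivative `D_i` in `L²(ℝᵈ)`: the pairs `(u, g)` with `D_i u = g` in the
sense of distributions. -/
def weakPartialGraph {d : ℕ} (i : Fin d) : Submodule ℝ (L2 d × L2 d) where
  carrier := {p | ∀ φ : EuclideanSpace ℝ (Fin d) → ℝ, IsTest φ →
    ∫ x, p.1 x * pderiv i φ x = -∫ x, p.2 x * φ x}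
  zero_mem' := by
    intro φ _
    simp
  add_mem' := by
    intro p q hp hq φ hφ
    have h : ∀ (u v : L2 d) {ψ : EuclideanSpace ℝ (Fin d) → ℝ}, MemLp ψ 2 volume →
        ∫ x, (u + v) x * ψ x = (∫ x, u x * ψ x) + ∫ x, v x * ψ x := by
      intro u v ψ hψ
      rw [← integral_add (L2.integrable_mul u hψ) (L2.integrable_mul v hψ)]
      refine integral_congr_ae ?_
      filter_upwards [Lp.coeFn_add u v] with x hx
      simp only [hx, Pi.add_apply, add_mul]
    rw [Prod.fst_add, Prod.snd_add, h _ _ (hφ.memLp_pderiv i), h _ _ hφ.memLp, hp φ hφ, hq φ hφ]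
    ring
  smul_mem' := by
    intro c p hp φ hφ
    have h : ∀ (u : L2 d) (ψ : EuclideanSpace ℝ (Fin d) → ℝ),
        ∫ x, (c • u) x * ψ x = c * ∫ x, u x * ψ x := by
      intro u ψ
      rw [← integral_const_mul]
      refine integral_congr_ae ?_
      filter_upwards [Lp.coeFn_smul c u] with x hx
      simp only [hx, Pi.smul_apply, smul_eq_mul, mul_assoc]
    rw [Prod.smul_fst, Prod.smul_snd, h, h, hp φ hφ]
    ring

/-- The Sobolev space `H¹(ℝᵈ)`: all first order weak derivatives are in `L²(ℝᵈ)`. -/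
def MemH1 {d : ℕ} (u : L2 d) : Prop :=
  ∀ i : Fin d, ∃ g : L2 d, (u, g) ∈ weakPartialGraph i

theorem weakPartialGraph_unique {d : ℕ} {i : Fin d} {u g g' : L2 d}
    (h : (u, g) ∈ weakPartialGraph i) (h' : (u, g') ∈ weakPartialGraph i) : g = g' := by
  have h0 : ((0 : L2 d), g - g') ∈ weakPartialGraph i := by
    simpa using (weakPartialGraph i).sub_mem h h'
  refine sub_eq_zero.1 (L2.eq_zero_of_test _ fun φ hφ => ?_)
  have h1 := h0 φ hφ
  have h2 : ∫ x, (0 : L2 d) x * pderiv i φ x = 0 := by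
    simp
  dsimp only at h1
  linarith

namespace DiffusionMatrix

variable {d : ℕ}

/-- Uniform ellipticity: `λ |ξ|² ≤ ξ* a(x) ξ` for some `λ > 0` and all `x, ξ`. -/
def UniformlyElliptic (a : DiffusionMatrix d) : Prop :=
  ∃ l : ℝ, 0 < l ∧ ∀ x ξ : EuclideanSpace ℝ (Fin d),
    l * ‖ξ‖ ^ 2 ≤ ∑ i, ∑ j, ξ i * a.coeff x i j * ξ j

/-- The distribution `∑ᵢⱼ D_i (a_ij g_j)`, for `g ∈ L²(ℝᵈ)ᵈ`, evaluated at a test function `φ`. -/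
def divDistrib (a : DiffusionMatrix d) (g : Fin d → L2 d)
    (φ : EuclideanSpace ℝ (Fin d) → ℝ) : ℝ :=
  -∑ i, ∑ j, ∫ x, a.coeff x i j * g j x * pderiv i φ x

theorem divDistrib_add (a : DiffusionMatrix d) (g h : Fin d → L2 d)
    {φ : EuclideanSpace ℝ (Fin d) → ℝ} (hφ : IsTest φ) :
    a.divDistrib (g + h) φ = a.divDistrib g φ + a.divDistrib h φ := by
  simp only [divDistrib, ← neg_add, ← Finset.sum_add_distrib]
  congr 1
  refine Finset.sum_congr rfl fun i _ => Finset.sum_congr rfl fun j _ => ?_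
  rw [← integral_add (a.integrable _ (hφ.memLp_pderiv i) i j)
    (a.integrable _ (hφ.memLp_pderiv i) i j)]
  refine integral_congr_ae ?_
  filter_upwards [Lp.coeFn_add (g j) (h j)] with x hx
  simp only [Pi.add_apply, hx]
  ring

theorem divDistrib_smul (a : DiffusionMatrix d) (c : ℝ) (g : Fin d → L2 d)
    (φ : EuclideanSpace ℝ (Fin d) → ℝ) :
    a.divDistrib (c • g) φ = c * a.divDistrib g φ := by
  simp only [divDistrib, mul_neg, Finset.mul_sum]
  congr 1
  refine Finset.sum_congr rfl fun i _ => Finset.sum_congr rfl fun j _ => ?_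
  rw [← integral_const_mul]
  refine integral_congr_ae ?_
  filter_upwards [Lp.coeFn_smul c (g j)] with x hx
  simp only [Pi.smul_apply, hx, smul_eq_mul]
  ring

/-- The graph of the operator `A`: the pairs `(u, f)` in `L²(ℝᵈ)` such that `u` is in `H¹(ℝᵈ)`, with
weak derivatives `D_j u = g_j`, and `∑ᵢⱼ D_i (a_ij D_j u) = f` in the sense of distributions. -/
def opGraph (a : DiffusionMatrix d) : Submodule ℝ (L2 d × L2 d) where
  carrier := {p | ∃ g : Fin d → L2 d, (∀ j, (p.1, g j) ∈ weakPartialGraph j) ∧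
    ∀ φ : EuclideanSpace ℝ (Fin d) → ℝ, IsTest φ → a.divDistrib g φ = ∫ x, p.2 x * φ x}
  zero_mem' := by
    refine ⟨0, fun j => (weakPartialGraph j).zero_mem, fun φ _ => ?_⟩
    have h1 : a.divDistrib 0 φ = 0 := by
      simpa using a.divDistrib_smul 0 0 φ
    simp [h1]
  add_mem' := by
    rintro p q ⟨g, hg, hg'⟩ ⟨h, hh, hh'⟩
    refine ⟨g + h, fun j => (weakPartialGraph j).add_mem (hg j) (hh j), fun φ hφ => ?_⟩
    rw [a.divDistrib_add g h hφ, hg' φ hφ, hh' φ hφ,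
      ← integral_add (L2.integrable_mul _ hφ.memLp) (L2.integrable_mul _ hφ.memLp)]
    refine integral_congr_ae ?_
    filter_upwards [Lp.coeFn_add p.2 q.2] with x hx
    simp only [Prod.snd_add, hx, Pi.add_apply, add_mul]
  smul_mem' := by
    rintro c p ⟨g, hg, hg'⟩
    refine ⟨c • g, fun j => (weakPartialGraph j).smul_mem c (hg j), fun φ hφ => ?_⟩
    rw [a.divDistrib_smul, hg' φ hφ, ← integral_const_mul]
    refine integral_congr_ae ?_
    filter_upwards [Lp.coeFn_smul c p.2] with x hx
    simp only [Prod.smul_snd, hx, Pi.smul_apply, smul_eq_mul, mul_assoc]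

/-- The unbounded operator `A u = ∑ᵢⱼ D_i (a_ij D_j u)` on `L²(ℝᵈ)`, with domain
`D(A) = {u ∈ H¹(ℝᵈ) : ∑ᵢⱼ D_i (a_ij D_j u) ∈ L²(ℝᵈ)}`; see `op_graph` and `mem_domain_op`. -/
def op (a : DiffusionMatrix d) : L2 d →ₗ.[ℝ] L2 d :=
  a.opGraph.toLinearPMap

theorem op_graph (a : DiffusionMatrix d) : a.op.graph = a.opGraph := by
  refine Submodule.toLinearPMap_graph_eq _ ?_
  rintro ⟨u, f⟩ ⟨g, hg, hf⟩ hu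
  dsimp only at hu hg hf ⊢
  subst hu
  have hg0 : g = 0 := funext fun j =>
    weakPartialGraph_unique (hg j) (weakPartialGraph j).zero_mem
  subst hg0
  refine L2.eq_zero_of_test f fun φ hφ => ?_
  rw [← hf φ hφ]
  simpa using a.divDistrib_smul 0 0 φ

theorem mem_domain_op (a : DiffusionMatrix d) (u : L2 d) :
    u ∈ a.op.domain ↔ MemH1 u ∧ ∃ f : L2 d, ∀ g : Fin d → L2 d,
      (∀ j, (u, g j) ∈ weakPartialGraph j) →
      ∀ φ : EuclideanSpace ℝ (Fin d) → ℝ, IsTest φ → a.divDistrib g φ = ∫ x, f x * φ x := by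
  rw [LinearPMap.mem_domain_iff, op_graph]
  constructor
  · rintro ⟨f, g, hg, hf⟩
    refine ⟨fun i => ⟨g i, hg i⟩, f, fun g' hg' => ?_⟩
    have : g' = g := funext fun j => weakPartialGraph_unique (hg' j) (hg j)
    subst this
    exact hf
  · rintro ⟨h1, f, hf⟩
    choose g hg using h1
    exact ⟨f, g, hg, hf g hg⟩

end DiffusionMatrix

end

/-! The operator is maximal dissipative, and the Hille–Yosida construction on a Hilbert space does
the rest. Dissipativity is `⟨Au, u⟩ = -∫ a∇u·∇u ≤ 0`; surjectivity of `ν - A` is Lax–Milgram on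
`H¹`, with coercivity from ellipticity (`op_isMaxDissipative`). Both need the weak equation against
all of `H¹` and not only against test functions, hence the density of test functions, proved by
duality, mollification and cut-off (`eq_zero_of_orthogonal_test`).

On the abstract side `A` is replaced by the bounded operators `Aₙ = ν(Jₙ - 1)`, with `Jₙ = ν(ν -
A)⁻¹` and `ν = n + 1`. Their exponentials are commuting contractions, so `‖exp(tAₙ)x - exp(tAₘ)x‖ ≤
t‖Aₙx - Aₘx‖`, and `Aₙx → Ax` on the domain. The uniform limit `S x` satisfies `(S x)' = S(Ax) = A(S
x)` for `x` in the domain (`exists_evolution`). Hence `S(Aⁱu₀)` is both the `i`-th derivative of the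
solution and `Aⁱ` applied to it, which gives regularity in every graph norm at once
(`memCPowDom_of_orbit`). Uniqueness is the decay of `‖v - u‖²`. -/

noncomputable section

/-! ### Maximal dissipative operators on a Hilbert space -/

namespace LinearPMap

open Filter Topology

variable {H : Type*} [NormedAddCommGroup H] [InnerProductSpace ℝ H]

/-- `A` is dissipative, and `ν - A` is onto for every `ν > 0`. -/
structure IsMaxDissipative (A : H →ₗ.[ℝ] H) : Prop where
  inner_nonpos : ∀ x : A.domain, inner ℝ (A x) (x : H) ≤ 0
  surj : ∀ ν : ℝ, 0 < ν → ∀ f : H, ∃ x : A.domain, ν • (x : H) - A x = f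

/-- `J = ν (ν - A)⁻¹`, a contraction of `H`. -/
structure IsResolvent (A : H →ₗ.[ℝ] H) (ν : ℝ) (J : H →L[ℝ] H) : Prop where
  norm_le : ∀ f, ‖J f‖ ≤ ‖f‖
  eq : ∀ f, ∃ x : A.domain, (x : H) = J f ∧ A x = ν • (J f - f)

namespace IsMaxDissipative

variable {A : H →ₗ.[ℝ] H}

theorem norm_le (hA : A.IsMaxDissipative) {ν : ℝ} (x : A.domain) : ν * ‖(x : H)‖ ≤ ‖ν • (x : H) - A x‖ := by
  rcases eq_or_lt_of_le (norm_nonneg (x : H)) with h | h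
  · rw [← h, mul_zero]
    exact norm_nonneg _
  refine le_of_mul_le_mul_right ?_ h
  calc ν * ‖(x : H)‖ * ‖(x : H)‖ = ν * inner ℝ (x : H) (x : H) := by
        rw [real_inner_self_eq_norm_sq]; ring
    _ ≤ inner ℝ (ν • (x : H) - A x) (x : H) := by
        rw [inner_sub_left, real_inner_smul_left]
        linarith [hA.inner_nonpos x]
    _ ≤ _ := real_inner_le_norm _ _

theorem eq_of_sub_eq (hA : A.IsMaxDissipative) {ν : ℝ} (hν : 0 < ν) {x y : A.domain}
    (h : ν • (x : H) - A x = ν • (y : H) - A y) : x = y := by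
  have h1 := hA.norm_le (ν := ν) (x - y)
  rw [A.map_sub, AddSubgroupClass.coe_sub, smul_sub,
    show ν • (x : H) - ν • (y : H) - (A x - A y) = (ν • (x : H) - A x) - (ν • (y : H) - A y) by abel,
    h, sub_self, norm_zero] at h1
  have h2 : ‖(x : H) - y‖ ≤ 0 := nonpos_of_mul_nonpos_right h1 hν
  exact Subtype.ext (sub_eq_zero.1 (norm_le_zero_iff.1 h2))

/-- Solutions of `ν x - A x = ν f` are unique, so any choice of them is linear in `f`; the a priori
bound makes it a contraction. -/
theorem exists_isResolvent (hA : A.IsMaxDissipative) {ν : ℝ} (hν : 0 < ν) : ∃ J : H →L[ℝ] H, A.IsResolvent ν J := by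
  choose R hR using fun f => hA.surj ν hν (ν • f)
  let L : H →ₗ[ℝ] H :=
    { toFun := fun f => R f
      map_add' := fun f g => by
        have : R (f + g) = R f + R g := hA.eq_of_sub_eq hν <| by
          rw [hR, A.map_add, Submodule.coe_add, smul_add, smul_add, ← hR f, ← hR g]
          abel
        rw [this, Submodule.coe_add]
      map_smul' := fun c f => by
        have : R (c • f) = c • R f := hA.eq_of_sub_eq hν <| by
          rw [hR, A.map_smul, Submodule.coe_smul, smul_comm ν c, smul_comm ν c, ← smul_sub, hR f]
        rw [this, Submodule.coe_smul, RingHom.id_apply] }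
  have hL : ∀ f, ‖L f‖ ≤ 1 * ‖f‖ := fun f => by
    have h := hA.norm_le (ν := ν) (R f)
    rw [hR, norm_smul, Real.norm_of_nonneg hν.le] at h
    rw [one_mul]
    exact le_of_mul_le_mul_left h hν
  refine ⟨L.mkContinuous 1 hL, fun f => by simpa using hL f, fun f => ⟨R f, rfl, ?_⟩⟩
  have := hR f
  change A (R f) = ν • ((R f : H) - f)
  rw [smul_sub, ← this]
  abel

theorem resolvent_eq_of (hA : A.IsMaxDissipative) {ν : ℝ} (hν : 0 < ν) {J : H →L[ℝ] H} (hJ : A.IsResolvent ν J)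
    {x : A.domain} {f : H} (h : A x = ν • ((x : H) - f)) : J f = x := by
  obtain ⟨y, hy, hy'⟩ := hJ.eq f
  rw [← hy]
  congr 1
  refine hA.eq_of_sub_eq hν ?_
  rw [h, hy', hy, smul_sub, smul_sub]
  abel

/-- On the domain of `A`, the Yosida approximation `ν (J - 1)` is `J A`. -/
theorem yosida_apply (hA : A.IsMaxDissipative) {ν : ℝ} (hν : 0 < ν) {J : H →L[ℝ] H} (hJ : A.IsResolvent ν J)
    (x : A.domain) : ν • (J x - x) = J (A x) := by
  obtain ⟨y, hy, hy'⟩ := hJ.eq x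
  -- With `y = J x`, the vector `ν (y - x)` solves the resolvent equation with datum `A x`.
  have h : A (ν • (y - x)) = ν • (((ν • (y - x) : A.domain) : H) - A x) := by
    rw [A.map_smul, A.map_sub, hy', Submodule.coe_smul, AddSubgroupClass.coe_sub, hy]
  rw [hA.resolvent_eq_of hν hJ h, Submodule.coe_smul, AddSubgroupClass.coe_sub, hy]

/-- `K J f` solves the equation that characterises `J (K f)`, because `K` commutes with `A` on the
domain up to the Yosida identity. -/
theorem resolvent_comm (hA : A.IsMaxDissipative) {ν μ : ℝ} (hν : 0 < ν) (hμ : 0 < μ) {J K : H →L[ℝ] H}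
    (hJ : A.IsResolvent ν J) (hK : A.IsResolvent μ K) : Commute J K := by
  ext f
  obtain ⟨p, hp, hp'⟩ := hJ.eq f
  obtain ⟨z, hz, hz'⟩ := hK.eq (p : H)
  have h : A z = ν • ((z : H) - K f) := by
    rw [hz', hA.yosida_apply hμ hK p, hp', K.map_smul, K.map_sub, hz, hp]
  change J (K f) = K (J f)
  rw [hA.resolvent_eq_of hν hJ h, hz, hp]

theorem norm_resolvent_sub_le (hA : A.IsMaxDissipative) {ν : ℝ} (hν : 0 < ν) {J : H →L[ℝ] H} (hJ : A.IsResolvent ν J)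
    (x : A.domain) : ‖J x - x‖ ≤ ‖A x‖ / ν := by
  rw [le_div_iff₀' hν, ← Real.norm_of_nonneg hν.le, ← norm_smul, hA.yosida_apply hν hJ]
  exact hJ.norm_le _

/-- If `y = x - A x` is orthogonal to the domain, pairing it with `x` gives `‖x‖² = ⟨A x, x⟩ ≤ 0`.
-/
theorem dense_domain (hA : A.IsMaxDissipative) [CompleteSpace H] : Dense (A.domain : Set H) := by
  rw [Submodule.dense_iff_topologicalClosure_eq_top, Submodule.topologicalClosure_eq_top_iff,
    Submodule.eq_bot_iff]
  intro y hy
  obtain ⟨x, rfl⟩ := hA.surj 1 one_pos y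
  have h := (Submodule.mem_orthogonal' _ _).1 hy x x.2
  rw [one_smul, inner_sub_left, real_inner_self_eq_norm_sq] at h
  have h0 := hA.inner_nonpos x
  have hx : x = 0 := Subtype.ext (norm_eq_zero.1 (by
    have : ‖(x : H)‖ ^ 2 ≤ 0 := by linarith
    exact pow_eq_zero_iff two_ne_zero |>.1 (le_antisymm this (sq_nonneg _))))
  simp [hx]

/-- On the domain the error is at most `‖A x‖ / ν`; density and contractivity extend the convergence
to all of `H`. -/
theorem tendsto_resolvent (hA : A.IsMaxDissipative) [CompleteSpace H] {J : ℕ → H →L[ℝ] H}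
    (hJ : ∀ n : ℕ, A.IsResolvent (n + 1) (J n)) (y : H) :
    Tendsto (fun n => J n y) atTop (𝓝 y) := by
  rw [Metric.tendsto_atTop]
  intro ε hε
  obtain ⟨x, hx, hxy⟩ := Metric.mem_closure_iff.1 (hA.dense_domain y) (ε / 4) (by linarith)
  have h1 : Tendsto (fun n : ℕ => ‖A ⟨x, hx⟩‖ / ((n : ℝ) + 1)) atTop (𝓝 0) :=
    (tendsto_const_div_atTop_nhds_zero_nat ‖A ⟨x, hx⟩‖ |>.comp (tendsto_add_atTop_nat 1)).congr
      fun n => by simp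
  obtain ⟨N, hN⟩ := (h1.eventually (gt_mem_nhds (show 0 < ε / 4 by linarith))).exists_forall_of_atTop
  refine ⟨N, fun n hn => ?_⟩
  have h2 := hA.norm_resolvent_sub_le (by positivity) (hJ n) ⟨x, hx⟩
  have h3 := (hJ n).norm_le (y - x)
  have h4 := hN n hn
  rw [dist_eq_norm] at hxy ⊢
  calc ‖J n y - y‖ = ‖J n (y - x) + (J n x - x) + (x - y)‖ := by
        rw [(J n).map_sub]; abel_nf
    _ ≤ ‖J n (y - x)‖ + ‖J n x - x‖ + ‖x - y‖ := norm_add₃_le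
    _ < ε := by
        rw [norm_sub_rev x y]
        dsimp only at h2
        linarith

end IsMaxDissipative

/-! ### Exponentials of bounded dissipative operators -/

section Exponential

variable [CompleteSpace H]

theorem hasDerivAt_exp_smul_apply (B : H →L[ℝ] H) (x : H) (t : ℝ) :
    HasDerivAt (fun s : ℝ => NormedSpace.exp (s • B) x) (B (NormedSpace.exp (t • B) x)) t :=
  (hasDerivAt_exp_smul_const' B t).clm_apply (hasDerivAt_const t x) |>.congr_deriv (by simp)

/-- The squared norm along the flow has derivative `2⟨B u, u⟩ ≤ 0`. -/
theorem norm_exp_smul_apply_le {B : H →L[ℝ] H} (hB : ∀ x, inner ℝ (B x) x ≤ 0) {t : ℝ}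
    (ht : 0 ≤ t) (x : H) : ‖NormedSpace.exp (t • B) x‖ ≤ ‖x‖ := by
  have hd : ∀ s : ℝ, HasDerivAt (fun s : ℝ => ‖NormedSpace.exp (s • B) x‖ ^ 2)
      (2 * inner ℝ (NormedSpace.exp (s • B) x) (B (NormedSpace.exp (s • B) x))) s :=
    fun s => (hasDerivAt_exp_smul_apply B x s).norm_sq
  have hanti : Antitone fun s : ℝ => ‖NormedSpace.exp (s • B) x‖ ^ 2 :=
    antitone_of_hasDerivAt_nonpos hd fun s => by
      have h := hB (NormedSpace.exp (s • B) x)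
      rw [real_inner_comm] at h
      exact mul_nonpos_of_nonneg_of_nonpos two_pos.le h
  have h := hanti ht
  simp only [zero_smul, NormedSpace.exp_zero, one_apply_eq_self] at h
  exact le_of_sq_le_sq h (norm_nonneg _)

theorem norm_exp_smul_sub_exp_smul_le {B C : H →L[ℝ] H} (hB : ∀ x, inner ℝ (B x) x ≤ 0)
    (hC : ∀ x, inner ℝ (C x) x ≤ 0) (hBC : Commute B C) {t : ℝ} (ht : 0 ≤ t) (x : H) :
    ‖NormedSpace.exp (t • B) x - NormedSpace.exp (t • C) x‖ ≤ t * ‖B x - C x‖ := by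
  -- This path joins `exp(tC)x` at `s = 0` to `exp(tB)x` at `s = t`; commutativity brings `B - C`
  -- next to `x`, and both exponentials are contractions.
  have hd : ∀ s : ℝ, HasDerivAt
      (fun s : ℝ => NormedSpace.exp (s • B) (NormedSpace.exp ((t - s) • C) x))
      (NormedSpace.exp (s • B) (NormedSpace.exp ((t - s) • C) (B x - C x))) s := fun s => by
    have h1 := hasDerivAt_exp_smul_const B s
    have h2 : HasDerivAt (fun s : ℝ => NormedSpace.exp ((t - s) • C) x)
        (-C (NormedSpace.exp ((t - s) • C) x)) s := by
      simpa [Function.comp_def] using (hasDerivAt_exp_smul_apply C x (t - s)).scomp s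
        ((hasDerivAt_id s).const_sub t)
    refine (h1.clm_apply h2).congr_deriv ?_
    have h3 : Commute (NormedSpace.exp ((t - s) • C)) (B - C) :=
      ((hBC.symm.sub_right (Commute.refl C)).smul_left (t - s)).exp_left
    have h4 := DFunLike.congr_fun h3.eq x
    simp only [mul_apply_eq_comp, _root_.sub_apply] at h4
    rw [h4, mul_apply_eq_comp, ← ContinuousLinearMap.map_add, sub_eq_add_neg (B _)]
  have h := norm_image_sub_le_of_norm_deriv_le_segment' (a := 0) (b := t)
    (fun s _ => (hd s).hasDerivWithinAt) (C := ‖B x - C x‖) (fun s hs =>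
      (norm_exp_smul_apply_le hB hs.1 _).trans (norm_exp_smul_apply_le hC (by linarith [hs.2]) _))
    t (right_mem_Icc.2 ht)
  simpa [NormedSpace.exp_zero, mul_comm] using h

end Exponential

/-! ### Yosida approximation and passage to the limit -/

/-- The Yosida approximation `ν (J - 1) = A J` of `A`, for `J = ν (ν - A)⁻¹`. -/
def yosida (ν : ℝ) (J : H →L[ℝ] H) : H →L[ℝ] H := ν • (J - 1)

theorem yosida_apply_eq (ν : ℝ) (J : H →L[ℝ] H) (x : H) : yosida ν J x = ν • (J x - x) := rfl

theorem IsResolvent.yosida_inner_nonpos {A : H →ₗ.[ℝ] H} {ν : ℝ} (hν : 0 < ν) {J : H →L[ℝ] H}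
    (hJ : A.IsResolvent ν J) (x : H) : inner ℝ (yosida ν J x) x ≤ 0 := by
  rw [yosida_apply_eq, real_inner_smul_left, inner_sub_left, real_inner_self_eq_norm_sq]
  have h1 := real_inner_le_norm (J x) x
  have h2 := mul_le_mul_of_nonneg_right (hJ.norm_le x) (norm_nonneg x)
  exact mul_nonpos_of_nonneg_of_nonpos hν.le (by nlinarith)

namespace IsMaxDissipative

variable {A : H →ₗ.[ℝ] H}

theorem yosida_comm (hA : A.IsMaxDissipative) {ν μ : ℝ} (hν : 0 < ν) (hμ : 0 < μ)
    {J K : H →L[ℝ] H} (hJ : A.IsResolvent ν J) (hK : A.IsResolvent μ K) :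
    Commute (yosida ν J) (yosida μ K) :=
  ((((hA.resolvent_comm hν hμ hJ hK).sub_left (Commute.one_left K)).sub_right
    (Commute.one_right _)).smul_left ν).smul_right μ

/-- `A` is closed, since `(1 - A)⁻¹` is bounded: pass to the limit in `J (yₙ - A yₙ) = yₙ`. -/
theorem mem_domain_of_tendsto (hA : A.IsMaxDissipative) {y : ℕ → A.domain} {z f : H}
    (h1 : Tendsto (fun n => (y n : H)) atTop (𝓝 z)) (h2 : Tendsto (fun n => A (y n)) atTop (𝓝 f)) :
    ∃ h : z ∈ A.domain, A ⟨z, h⟩ = f := by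
  obtain ⟨J, hJ⟩ := hA.exists_isResolvent one_pos
  have h3 : ∀ n, J (y n - A (y n)) = y n := fun n =>
    hA.resolvent_eq_of one_pos hJ (by rw [one_smul, sub_sub_cancel])
  have h4 : J (z - f) = z := by
    refine tendsto_nhds_unique ((J.continuous.tendsto _).comp (h1.sub h2)) ?_
    simpa only [Function.comp_def, h3] using h1
  obtain ⟨x, hx, hx'⟩ := hJ.eq (z - f)
  rw [h4] at hx
  subst hx
  refine ⟨x.2, ?_⟩
  rw [Subtype.coe_eta, hx', h4, one_smul, sub_sub_cancel]

variable [CompleteSpace H]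

theorem tendsto_yosida (hA : A.IsMaxDissipative) {J : ℕ → H →L[ℝ] H}
    (hJ : ∀ n : ℕ, A.IsResolvent (n + 1) (J n)) (x : A.domain) :
    Tendsto (fun n : ℕ => yosida (n + 1) (J n) x) atTop (𝓝 (A x)) :=
  (hA.tendsto_resolvent hJ (A x)).congr fun n => by
    rw [yosida_apply_eq, hA.yosida_apply (by positivity) (hJ n)]

theorem exists_tendstoUniformlyOn (hA : A.IsMaxDissipative) {J : ℕ → H →L[ℝ] H}
    (hJ : ∀ n : ℕ, A.IsResolvent (n + 1) (J n)) (T : ℝ) (x : H) :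
    ∃ u : ℝ → H, TendstoUniformlyOn
      (fun (n : ℕ) (t : ℝ) => NormedSpace.exp (t • yosida (n + 1) (J n)) x) u atTop (Icc 0 T) := by
  have hpos : ∀ n : ℕ, (0 : ℝ) < n + 1 := fun n => by positivity
  have hdis : ∀ (n : ℕ) (x : H), inner ℝ (yosida (n + 1) (J n) x) x ≤ 0 := fun n =>
    (hJ n).yosida_inner_nonpos (hpos n)
  have hc : UniformCauchySeqOn
      (fun (n : ℕ) (t : ℝ) => NormedSpace.exp (t • yosida (n + 1) (J n)) x) atTop (Icc 0 T) := by
    rw [Metric.uniformCauchySeqOn_iff]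
    intro ε hε
    -- The part `x - z` costs `ε/4` under each exponential, and `z` costs `ε/2`. Using `|T| + 1`
    -- keeps the denominator positive for every `T`.
    obtain ⟨z, hz, hxz⟩ := Metric.mem_closure_iff.1 (hA.dense_domain x) (ε / 4) (by linarith)
    obtain ⟨N, hN⟩ := Metric.cauchySeq_iff.1 (hA.tendsto_yosida hJ ⟨z, hz⟩).cauchySeq
      (ε / (2 * (|T| + 1))) (by positivity)
    refine ⟨N, fun m hm n hn t ht => ?_⟩
    have h1 := norm_exp_smul_sub_exp_smul_le (hdis m) (hdis n)
      (hA.yosida_comm (hpos m) (hpos n) (hJ m) (hJ n)) ht.1 z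
    have h2 := norm_exp_smul_apply_le (hdis m) ht.1 (x - z)
    have h3 := norm_exp_smul_apply_le (hdis n) ht.1 (x - z)
    have h4 := hN m hm n hn
    rw [dist_eq_norm] at hxz h4 ⊢
    dsimp only at h4
    set E := NormedSpace.exp (t • yosida (m + 1) (J m))
    set F := NormedSpace.exp (t • yosida (n + 1) (J n))
    have h5 : t * ‖yosida (m + 1) (J m) z - yosida (n + 1) (J n) z‖ ≤ ε / 2 := by
      calc _ ≤ (|T| + 1) * (ε / (2 * (|T| + 1))) := by
            refine mul_le_mul ?_ h4.le (norm_nonneg _) (by positivity)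
            linarith [ht.2, le_abs_self T]
        _ = ε / 2 := by field_simp
    calc ‖E x - F x‖ = ‖E (x - z) + (E z - F z) - F (x - z)‖ := by
          rw [E.map_sub, F.map_sub]; abel_nf
      _ ≤ ‖E (x - z)‖ + ‖E z - F z‖ + ‖F (x - z)‖ :=
          (norm_sub_le _ _).trans (by gcongr; exact norm_add_le _ _)
      _ < ε := by linarith
  choose! u hu using fun t (ht : t ∈ Icc 0 T) => cauchySeq_tendsto_of_complete (hc.cauchySeq ht)
  exact ⟨u, hc.tendstoUniformlyOn_of_tendsto hu⟩

/-- The contraction semigroup generated by a maximal dissipative operator, on `[0, T]`. -/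
theorem exists_evolution (hA : A.IsMaxDissipative) {T : ℝ} (hT : 0 ≤ T) :
    ∃ S : H → ℝ → H, (∀ x, ContinuousOn (S x) (Icc 0 T)) ∧ (∀ x, S x 0 = x) ∧
      ∀ (x : A.domain), ∀ t ∈ Icc 0 T, HasDerivWithinAt (S x) (S (A x) t) (Icc 0 T) t ∧
        ∃ h : S x t ∈ A.domain, A ⟨S x t, h⟩ = S (A x) t := by
  have hpos : ∀ n : ℕ, (0 : ℝ) < n + 1 := fun n => by positivity
  choose J hJ using fun n : ℕ => hA.exists_isResolvent (hpos n)
  have hdis : ∀ (n : ℕ) (x : H), inner ℝ (yosida (n + 1) (J n) x) x ≤ 0 := fun n =>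
    (hJ n).yosida_inner_nonpos (hpos n)
  choose S hS using hA.exists_tendstoUniformlyOn hJ T
  have hcont : ∀ (n : ℕ) (x : H),
      Continuous fun t : ℝ => NormedSpace.exp (t • yosida (n + 1) (J n)) x := fun n x =>
    continuous_iff_continuousAt.2 fun t => (hasDerivAt_exp_smul_apply _ x t).continuousAt
  have hSc : ∀ x, ContinuousOn (S x) (Icc 0 T) := fun x =>
    (hS x).continuousOn (Frequently.of_forall fun n => (hcont n x).continuousOn)
  -- The initial datum `Aₙ x` varies with `n`; contractivity makes its distance to `A x` harmless
  -- uniformly in `t`.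
  have hlim : ∀ x : A.domain, TendstoUniformlyOn (fun (n : ℕ) (t : ℝ) =>
      NormedSpace.exp (t • yosida (n + 1) (J n)) (yosida (n + 1) (J n) x)) (S (A x)) atTop
      (Icc 0 T) := fun x => by
    rw [Metric.tendstoUniformlyOn_iff]
    intro ε hε
    filter_upwards [Metric.tendstoUniformlyOn_iff.1 (hS (A x)) (ε / 2) (by linarith),
      Metric.tendsto_nhds.1 (hA.tendsto_yosida hJ x) (ε / 2) (by linarith)] with n h1 h2 t ht
    have h3 := norm_exp_smul_apply_le (hdis n) ht.1 (yosida (n + 1) (J n) x - A x)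
    rw [dist_eq_norm] at h2
    rw [ContinuousLinearMap.map_sub, ← dist_eq_norm, dist_comm] at h3
    exact (dist_triangle _ _ _).trans_lt (by linarith [h1 t ht])
  refine ⟨S, hSc, fun x => ?_, fun x t ht => ⟨?_, ?_⟩⟩
  · refine tendsto_nhds_unique ((hS x).tendsto_at (left_mem_Icc.2 hT)) ?_
    simp [NormedSpace.exp_zero]
  -- The differential equation passes to the limit in integrated form.
  · have hint : ∀ s ∈ Icc 0 T, S x s = x + ∫ r in 0..s, S (A x) r := fun s hs => by
      have hsub : uIcc 0 s ⊆ Icc 0 T := by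
        rw [uIcc_of_le hs.1]
        exact Icc_subset_Icc_right hs.2
      have h1 := TendstoUniformlyOn.tendsto_intervalIntegral_of_continuousOn
        (μ := volume) (Eventually.of_forall fun n => (hcont n _).continuousOn)
        ((hlim x).mono hsub)
      refine tendsto_nhds_unique ((hS x).tendsto_at hs) ((h1.const_add (x : H)).congr fun n => ?_)
      have hcomm : ∀ r : ℝ, NormedSpace.exp (r • yosida (n + 1) (J n)) (yosida (n + 1) (J n) x) =
          yosida (n + 1) (J n) (NormedSpace.exp (r • yosida (n + 1) (J n)) x) := fun r =>
        DFunLike.congr_fun ((Commute.refl (yosida ((n : ℝ) + 1) (J n))).smul_left r).exp_left.eq (x : H)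
      rw [intervalIntegral.integral_eq_sub_of_hasDerivAt
        (fun r _ => (hasDerivAt_exp_smul_apply _ (x : H) r).congr_deriv (hcomm r).symm)
        ((hcont n _).intervalIntegrable _ _)]
      simp [NormedSpace.exp_zero]
    -- A continuous extension to the whole line lets the fundamental theorem of calculus cover the
    -- end points too.
    have hext : Continuous (IccExtend hT ((Icc 0 T).domRestrict (S (A x)))) :=
      (continuousOn_iff_continuous_domRestrict.1 (hSc _)).Icc_extend'
    have heq : ∀ s ∈ Icc 0 T, IccExtend hT ((Icc 0 T).domRestrict (S (A x))) s = S (A x) s :=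
      fun s hs => IccExtend_of_mem hT _ hs
    have hd := ((hext.integral_hasStrictDerivAt 0 t).hasDerivAt.const_add (x : H)).hasDerivWithinAt
      (s := Icc 0 T)
    rw [heq t ht] at hd
    refine hd.congr (fun s hs => ?_) ?_
    all_goals
      rw [hint _ (by assumption)]
      congr 1
      refine intervalIntegral.integral_congr fun r hr => (heq r ?_).symm
      rw [uIcc_of_le (by first | exact hs.1 | exact ht.1)] at hr
      exact ⟨hr.1, hr.2.trans (by first | exact hs.2 | exact ht.2)⟩
  -- `yₙ = Jₙ exp(tAₙ)x` lies in the domain and tends to `S x t`, while `A yₙ = exp(tAₙ)Aₙx` tends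
  -- to `S (A x) t`; closedness concludes.
  · choose y hy hy' using fun n : ℕ =>
      (hJ n).eq (NormedSpace.exp (t • yosida (n + 1) (J n)) (x : H))
    refine hA.mem_domain_of_tendsto (y := y) ?_ (((hlim x).tendsto_at ht).congr fun n => ?_)
    · simp only [hy]
      have h1 := (hS x).tendsto_at ht
      have h2 : Tendsto (fun n : ℕ =>
          J n (NormedSpace.exp (t • yosida (n + 1) (J n)) (x : H) - S x t)) atTop (𝓝 0) :=
        squeeze_zero_norm (fun n => (hJ n).norm_le _) (tendsto_iff_norm_sub_tendsto_zero.1 h1)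
      have h3 := h2.add (hA.tendsto_resolvent hJ (S x t))
      rw [zero_add] at h3
      refine h3.congr fun n => ?_
      rw [ContinuousLinearMap.map_sub, sub_add_cancel]
    · rw [hy', ← yosida_apply_eq]
      exact DFunLike.congr_fun
        ((Commute.refl (yosida ((n : ℝ) + 1) (J n))).smul_left t).exp_left.eq (x : H)

end IsMaxDissipative
-- Orbits, graph norms and time regularity
/-- Along an orbit `x i`, with `x i ∈ D(A)` and `A (x i) = x (i + 1)` for `i < n`, all the powers
of `A` up to the `n`-th are defined. -/
theorem mem_powDomain_of_orbit {A : H →ₗ.[ℝ] H} {n : ℕ} {x : ℕ → H}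
    (h : ∀ i < n, ∃ hx : x i ∈ A.domain, A ⟨x i, hx⟩ = x (i + 1)) : x 0 ∈ A.powDomain n := by
  induction n generalizing x with
  | zero => exact Submodule.mem_top
  | succ n ih =>
    obtain ⟨h0, h0'⟩ := h 0 n.succ_pos
    refine ⟨ih fun i hi => h i (hi.trans n.lt_succ_self), h0, ?_⟩
    rw [h0']
    exact ih (x := fun i => x (i + 1)) fun i hi => h (i + 1) (Nat.succ_lt_succ hi)

theorem powMap_of_orbit {A : H →ₗ.[ℝ] H} {n : ℕ} {x : ℕ → H}
    (h : ∀ i < n, ∃ hx : x i ∈ A.domain, A ⟨x i, hx⟩ = x (i + 1)) (h0 : x 0 ∈ A.powDomain n) :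
    A.powMap n ⟨x 0, h0⟩ = x n := by
  induction n generalizing x with
  | zero => rfl
  | succ n ih =>
    obtain ⟨hx, hx'⟩ := h 0 n.succ_pos
    have hs : ∀ i < n, ∃ hx : x (i + 1) ∈ A.domain, A ⟨x (i + 1), hx⟩ = x (i + 1 + 1) :=
      fun i hi => h (i + 1) (Nat.succ_lt_succ hi)
    rw [← ih (x := fun i => x (i + 1)) hs (mem_powDomain_of_orbit hs)]
    change A.powMap n (A.powStep n _) = _
    congr 1
    exact Subtype.ext hx'

/-- Encodes iterated domains by plain sequences `v, A v, …, Aⁿ v`; the entries after the `n`-th are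
fillers. -/
theorem exists_orbit {A : H →ₗ.[ℝ] H} {n : ℕ} {v : H} (hv : v ∈ A.powDomain n) :
    ∃ x : ℕ → H, x 0 = v ∧ ∀ i < n, ∃ hx : x i ∈ A.domain, A ⟨x i, hx⟩ = x (i + 1) := by
  induction n generalizing v with
  | zero => exact ⟨fun _ => v, rfl, fun i hi => absurd hi (Nat.not_lt_zero i)⟩
  | succ n ih =>
    obtain ⟨-, h, h'⟩ := hv
    obtain ⟨x, hx0, hx⟩ := ih h'
    refine ⟨fun i => Nat.casesOn i v x, rfl, fun i hi => ?_⟩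
    cases i with
    | zero => exact ⟨h, hx0.symm⟩
    | succ i => exact hx i (Nat.lt_of_succ_lt_succ hi)

/-- The map `v ↦ (v, A v, …, Aᵏ v)`, as an isometry from `D(Aᵏ)` with its graph norm. -/
def PowDom.orbitIsometry (A : H →ₗ.[ℝ] H) (k : ℕ) :
    PowDom A k →ₗᵢ[ℝ] PiLp 2 (fun _ : Fin (k + 1) => H) where
  toLinearMap := PowDom.orbit A k
  norm_map' _ := rfl

/-- The isometry preserves the norm of the first-order remainder, so neither completeness nor closed
range is needed. It transfers derivatives from the Hilbert sum back to the graph norm. -/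
theorem _root_.LinearIsometry.hasDerivWithinAt_comp_iff {E F : Type*} [NormedAddCommGroup E]
    [NormedSpace ℝ E] [NormedAddCommGroup F] [NormedSpace ℝ F] (L : E →ₗᵢ[ℝ] F) {f : ℝ → E}
    {f' : E} {s : Set ℝ} {t : ℝ} :
    HasDerivWithinAt (fun r => L (f r)) (L f') s t ↔ HasDerivWithinAt f f' s t := by
  rw [hasDerivWithinAt_iff_isLittleO, hasDerivWithinAt_iff_isLittleO,
    ← Asymptotics.isLittleO_norm_left, ← Asymptotics.isLittleO_norm_left (f' := fun r =>
      f r - f t - (r - t) • f')]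
  simp only [← L.map_smul, ← L.map_sub, L.norm_map]

theorem contDiffOn_of_hasDerivWithinAt_succ {E : Type*} [NormedAddCommGroup E] [NormedSpace ℝ E]
    {s : Set ℝ} (hs : UniqueDiffOn ℝ s) {m : ℕ} {w : ℕ → ℝ → E}
    (hc : ContinuousOn (w m) s)
    (hd : ∀ i < m, ∀ t ∈ s, HasDerivWithinAt (w i) (w (i + 1) t) s t) :
    ContDiffOn ℝ m (w 0) s := by
  induction m generalizing w with
  | zero => exact contDiffOn_zero.2 hc
  | succ m ih =>
    have h0 := hd 0 m.succ_pos
    rw [Nat.cast_succ, contDiffOn_succ_iff_derivWithin hs]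
    refine ⟨fun t ht => (h0 t ht).differentiableWithinAt, fun h => absurd h (by simp), ?_⟩
    refine (ih (w := fun i => w (i + 1)) hc fun i hi => hd (i + 1) (Nat.succ_lt_succ hi)).congr
      fun t ht => (h0 t ht).derivWithin (hs t ht)

/-- If `u i`, for `i ≤ k`, are functions such that `u i' = A (u i) = u (i + 1)`, then
`u 0 ∈ Cᵐ([0, T]; D(Aʲ))` for `m + j ≤ k`. -/
theorem memCPowDom_of_orbit {A : H →ₗ.[ℝ] H} {T : ℝ} (hT : 0 < T) {k : ℕ} {u : ℕ → ℝ → H}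
    (hc : ∀ i, ContinuousOn (u i) (Icc 0 T))
    (hd : ∀ i < k, ∀ t ∈ Icc 0 T, HasDerivWithinAt (u i) (u (i + 1) t) (Icc 0 T) t)
    (hA : ∀ i < k, ∀ t ∈ Icc 0 T, ∃ h : u i t ∈ A.domain, A ⟨u i t, h⟩ = u (i + 1) t)
    {m j : ℕ} (hmj : m + j ≤ k) : A.MemCPowDom T m j (u 0) := by
  classical
  have hmem : ∀ i ≤ m, ∀ t ∈ Icc 0 T, u i t ∈ A.powDomain j := fun i hi t ht =>
    mem_powDomain_of_orbit (x := fun l => u (i + l) t) fun l hl => hA (i + l) (by omega) t ht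
  -- Under the orbit isometry `w i` becomes the tuple `(u i, …, u (i + j))`, so calculus in the
  -- graph norm is componentwise. The value `0` is never met on `[0, T]` for `i ≤ m`.
  let w : ℕ → ℝ → PowDom A j := fun i t =>
    if h : u i t ∈ A.powDomain j then (⟨u i t, h⟩ : A.powDomain j) else 0
  have hw' : ∀ i t (h : u i t ∈ A.powDomain j), w i t = (⟨u i t, h⟩ : A.powDomain j) :=
    fun i t h => dif_pos h
  have hw : ∀ i ≤ m, ∀ t ∈ Icc 0 T, PowDom.orbitIsometry A j (w i t) =
      WithLp.toLp 2 fun l : Fin (j + 1) => u (i + l) t := fun i hi t ht => by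
    ext l
    rw [hw' i t (hmem i hi t ht)]
    exact powMap_of_orbit (n := l) (x := fun l => u (i + l) t)
      (fun l' hl => hA (i + l') (by have := l.2; omega) t ht) _
  have hUD : UniqueDiffOn ℝ (Icc 0 T) := uniqueDiffOn_Icc hT
  refine ⟨w 0, contDiffOn_of_hasDerivWithinAt_succ hUD ?_ ?_, fun t ht => ?_⟩
  · rw [(PowDom.orbitIsometry A j).isometry.isEmbedding.isInducing.continuousOn_iff]
    refine ContinuousOn.congr ?_ (hw m le_rfl)
    exact (PiLp.continuous_toLp 2 _).comp_continuousOn (continuousOn_pi.2 fun l => hc _)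
  · intro i hi t ht
    rw [← (PowDom.orbitIsometry A j).hasDerivWithinAt_comp_iff, hw (i + 1) hi t ht]
    refine HasDerivWithinAt.congr ?_ (hw i hi.le) (hw i hi.le t ht)
    have h1 : HasDerivWithinAt (fun t (l : Fin (j + 1)) => u (i + l) t)
        (fun l : Fin (j + 1) => u (i + 1 + l) t) (Icc 0 T) t :=
      hasDerivWithinAt_pi.2 fun l => by
        rw [Nat.add_right_comm]
        exact hd (i + l) (by have := l.2; omega) t ht
    exact (PiLp.continuousLinearEquiv 2 ℝ
      (fun _ : Fin (j + 1) => H)).symm.hasFDerivAt.comp_hasDerivWithinAt t h1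
  · rw [hw' 0 t (hmem 0 (Nat.zero_le _) t ht)]
    rfl

/-- Energy argument: `‖v - u‖²` starts at zero and has derivative `2⟨A(v - u), v - u⟩ ≤ 0`. -/
theorem IsStrongSolution.eqOn {A : H →ₗ.[ℝ] H} (hA : A.IsMaxDissipative) {T : ℝ} {u₀ : H}
    {u v : ℝ → H} (hu : A.IsStrongSolution T u₀ u) (hv : A.IsStrongSolution T u₀ v) :
    EqOn v u (Icc 0 T) := by
  intro t ht
  have hd : ∀ s ∈ Icc 0 T, ∃ c ≤ 0,
      HasDerivWithinAt (fun s => ‖v s - u s‖ ^ 2) c (Icc 0 T) s := fun s hs => by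
    obtain ⟨h1, h1'⟩ := hu.hasDeriv s hs
    obtain ⟨h2, h2'⟩ := hv.hasDeriv s hs
    refine ⟨_, ?_, (h2'.sub h1').norm_sq⟩
    have h := hA.inner_nonpos (⟨v s, h2⟩ - ⟨u s, h1⟩)
    rw [A.map_sub, real_inner_comm] at h
    exact mul_nonpos_of_nonneg_of_nonpos two_pos.le h
  have hanti : AntitoneOn (fun s => ‖v s - u s‖ ^ 2) (Icc 0 T) := by
    refine antitoneOn_of_deriv_nonpos (convex_Icc 0 T)
      (fun s hs => (hd s hs).choose_spec.2.continuousWithinAt) (fun s hs => ?_) fun s hs => ?_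
    all_goals
      obtain ⟨c, hc, hc'⟩ := hd s (interior_subset hs)
      have hc'' := hc'.hasDerivAt (mem_interior_iff_mem_nhds.1 hs)
    · exact hc''.differentiableAt.differentiableWithinAt
    · rwa [hc''.deriv]
  have h := hanti (left_mem_Icc.2 (ht.1.trans ht.2)) ht ht.1
  simp only [hu.initial, hv.initial, sub_self, norm_zero] at h
  have h0 : ‖v t - u t‖ = 0 := by
    refine (pow_eq_zero_iff two_ne_zero).1 (le_antisymm ?_ (sq_nonneg _))
    simpa using h
  exact sub_eq_zero.1 (norm_eq_zero.1 h0)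

/-- The abstract Cauchy problem for a maximal dissipative operator: existence, uniqueness and
regularity of strong solutions. -/
theorem IsMaxDissipative.exists_isStrongSolution [CompleteSpace H] {A : H →ₗ.[ℝ] H}
    (hA : A.IsMaxDissipative) {T : ℝ} (hT : 0 < T) {u₀ : H} (hu₀ : u₀ ∈ A.domain) :
    ∃ u : ℝ → H, A.IsStrongSolution T u₀ u ∧
      (∀ v : ℝ → H, A.IsStrongSolution T u₀ v → EqOn v u (Icc 0 T)) ∧
      ∀ k : ℕ, u₀ ∈ A.powDomain k → ∀ j ≤ k, A.MemCPowDom T (k - j) j u := by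
  obtain ⟨S, hSc, hS0, hS⟩ := hA.exists_evolution hT.le
  have hreg : ∀ k : ℕ, u₀ ∈ A.powDomain k → ∀ j ≤ k, A.MemCPowDom T (k - j) j (S u₀) := by
    intro k hk j hj
    -- Applying `S` to the orbit of `u₀` gives functions in which each is both the derivative of its
    -- predecessor and its image under `A`.
    obtain ⟨x, rfl, hx⟩ := exists_orbit hk
    refine memCPowDom_of_orbit (u := fun i => S (x i)) (k := k) hT (fun i => hSc _) ?_ ?_
      (Nat.sub_add_cancel hj).le
    all_goals
      intro i hi t ht
      obtain ⟨h, h'⟩ := hx i hi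
      rw [← h']
    · exact (hS ⟨x i, h⟩ t ht).1
    · exact (hS ⟨x i, h⟩ t ht).2
  have h1 : u₀ ∈ A.powDomain 1 := A.powDomain_one ▸ hu₀
  have hsol : A.IsStrongSolution T u₀ (S u₀) := by
    refine ⟨?_, hreg 1 h1 1 le_rfl, fun t ht => ?_, hS0 u₀⟩
    · refine contDiffOn_of_hasDerivWithinAt_succ (m := 1) (uniqueDiffOn_Icc hT)
        (w := fun i => if i = 0 then S u₀ else S (A ⟨u₀, hu₀⟩)) (hSc _) fun i hi t ht => ?_
      obtain rfl := Nat.lt_one_iff.1 hi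
      exact (hS ⟨u₀, hu₀⟩ t ht).1
    · obtain ⟨h, h', h''⟩ := hS ⟨u₀, hu₀⟩ t ht
      exact ⟨h', h''.symm ▸ h⟩
  exact ⟨S u₀, hsol, fun v hv => hsol.eqOn hA hv, hreg⟩

end LinearPMap

/-! ### Test functions and mollification -/

open scoped Convolution
open ContinuousLinearMap (mul)

section TestFunctions

variable {d : ℕ}

local notation "Rd" => EuclideanSpace ℝ (Fin d)

theorem IsTest.differentiable {φ : Rd → ℝ} (h : IsTest φ) : Differentiable ℝ φ :=
  h.1.differentiable (by simp)

theorem IsTest.pderiv {φ : Rd → ℝ} (h : IsTest φ) (i : Fin d) : IsTest (pderiv i φ) :=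
  ⟨(h.1.fderiv_right (m := ∞) (by simp)).clm_apply contDiff_const, h.2.fderiv_apply (𝕜 := ℝ) _⟩

theorem IsTest.mul {φ ψ : Rd → ℝ} (hφ : IsTest φ) (hψ : IsTest ψ) :
    IsTest fun x => φ x * ψ x :=
  ⟨hφ.1.mul hψ.1, hφ.2.mul_right⟩

theorem IsTest.exists_bound {φ : Rd → ℝ} (h : IsTest φ) : ∃ C, 0 ≤ C ∧ ∀ x, |φ x| ≤ C := by
  obtain ⟨C, hC⟩ := h.2.exists_bound_of_continuous h.continuous
  exact ⟨C, (norm_nonneg _).trans (hC 0), hC⟩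

theorem IsTest.integrable {φ : Rd → ℝ} (h : IsTest φ) : Integrable φ :=
  h.continuous.integrable_of_hasCompactSupport h.2

theorem pderiv_mul {φ ψ : Rd → ℝ} (hφ : Differentiable ℝ φ) (hψ : Differentiable ℝ ψ) (i : Fin d)
    (x : Rd) : pderiv i (fun x => φ x * ψ x) x = φ x * pderiv i ψ x + ψ x * pderiv i φ x := by
  rw [pderiv, fderiv_fun_mul (hφ x) (hψ x)]
  rfl

theorem IsTest.comp_sub_left {φ : Rd → ℝ} (h : IsTest φ) (x : Rd) :
    IsTest fun y => φ (x - y) :=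
  ⟨h.1.comp (contDiff_const.sub contDiff_id),
    h.2.comp_homeomorph (Homeomorph.subLeft x)⟩

theorem pderiv_comp_sub_left {φ : Rd → ℝ} (h : Differentiable ℝ φ) (i : Fin d) (x y : Rd) :
    _root_.pderiv i (fun y => φ (x - y)) y = -_root_.pderiv i φ (x - y) := by
  have h1 : HasFDerivAt (fun y => φ (x - y)) (-(fderiv ℝ φ (x - y))) y := by
    refine ((h (x - y)).hasFDerivAt.comp y ((hasFDerivAt_id y).const_sub x)).congr_fderiv ?_
    ext v
    simp
  rw [_root_.pderiv, h1.fderiv]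
  rfl

theorem IsTest.integral_mul_pderiv {φ ψ : Rd → ℝ} (hφ : IsTest φ) (hψ : IsTest ψ) (i : Fin d) :
    ∫ x, φ x * _root_.pderiv i ψ x = -∫ x, _root_.pderiv i φ x * ψ x :=
  integral_mul_fderiv_eq_neg_fderiv_mul_of_integrable
    ((hφ.pderiv i).mul hψ).integrable (hφ.mul (hψ.pderiv i)).integrable (hφ.mul hψ).integrable
    (fun x _ => hφ.differentiable x) fun x _ => hψ.differentiable x

theorem isTest_convolution {v : Rd → ℝ} (hv : LocallyIntegrable v) (hv' : HasCompactSupport v)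
    {ρ : Rd → ℝ} (hρ : IsTest ρ) : IsTest (v ⋆[mul ℝ ℝ] ρ) :=
  ⟨hρ.2.contDiff_convolution_right _ hv hρ.1, hv'.convolution _ hρ.2⟩

theorem pderiv_convolution {v : Rd → ℝ} (hv : LocallyIntegrable v) {ρ : Rd → ℝ} (hρ : IsTest ρ)
    (i : Fin d) (x : Rd) :
    pderiv i (v ⋆[mul ℝ ℝ] ρ) x = (v ⋆[mul ℝ ℝ] pderiv i ρ) x := by
  have h1 : ContDiff ℝ 1 ρ := hρ.1.of_le (by simp)
  rw [pderiv, (hρ.2.hasFDerivAt_convolution_right (mul ℝ ℝ) hv h1 x).fderiv,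
    convolution_precompR_apply _ hv (hρ.2.fderiv ℝ) (h1.continuous_fderiv one_ne_zero)]
  rfl

/-- If `g` is the weak derivative of `v`, then `∂ᵢ (v ⋆ ρ) = g ⋆ ρ`. -/
theorem pderiv_convolution_of_weak {v g : Rd → ℝ} (hv : LocallyIntegrable v) {i : Fin d}
    (h : ∀ ψ : Rd → ℝ, IsTest ψ → ∫ x, v x * pderiv i ψ x = -∫ x, g x * ψ x)
    {ρ : Rd → ℝ} (hρ : IsTest ρ) : pderiv i (v ⋆[mul ℝ ℝ] ρ) = g ⋆[mul ℝ ℝ] ρ := by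
  ext x
  have h1 := h _ (hρ.comp_sub_left x)
  simp only [pderiv_comp_sub_left hρ.differentiable, mul_neg, integral_neg, neg_inj] at h1
  rw [pderiv_convolution hv hρ]
  exact h1

theorem convolution_mul_swap_apply (v ρ : Rd → ℝ) (x : Rd) :
    (v ⋆[mul ℝ ℝ] ρ) x = ∫ y, ρ y * v (x - y) := by
  rw [convolution_def, ← integral_sub_left_eq_self _ volume x]
  refine integral_congr_ae (Filter.Eventually.of_forall fun y => ?_)
  simp [mul_comm]

/-- Fubini turns the pairing with a mollification into the pairing of the kernel with a correlation
function. -/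
theorem integral_mul_convolution {w v : Rd → ℝ} (hw : MemLp w 2 volume) (hv : MemLp v 2 volume)
    {ρ : Rd → ℝ} (hρ : IsTest ρ) :
    ∫ x, w x * (v ⋆[mul ℝ ℝ] ρ) x = ∫ y, ρ y * ∫ x, w x * v (x - y) := by
  have hm : AEStronglyMeasurable (fun p : Rd × Rd => w p.1 * (ρ p.2 * v (p.1 - p.2)))
      (volume.prod volume) :=
    hw.1.comp_fst.mul (hρ.continuous.aestronglyMeasurable.convolution_integrand (mul ℝ ℝ) hv.1)
  have h1 : Integrable (fun p : Rd × Rd => w p.1 ^ 2 * |ρ p.2|) (volume.prod volume) :=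
    hw.integrable_sq.mul_prod hρ.integrable.abs
  have h2 : Integrable (fun p : Rd × Rd => |ρ p.2| * v (p.1 - p.2) ^ 2) (volume.prod volume) :=
    hρ.integrable.abs.convolution_integrand (mul ℝ ℝ) hv.integrable_sq
  have hint : Integrable (fun p : Rd × Rd => w p.1 * (ρ p.2 * v (p.1 - p.2)))
      (volume.prod volume) := by
    -- Domination by `|wρv| ≤ |ρ|(w² + v²)`.
    refine (h1.add h2).mono' hm (Filter.Eventually.of_forall fun p => ?_)
    rw [Real.norm_eq_abs, abs_mul, abs_mul, Pi.add_apply, ← sq_abs (w p.1), ← sq_abs (v _)]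
    nlinarith [abs_nonneg (ρ p.2), mul_nonneg (abs_nonneg (ρ p.2))
      (sq_nonneg (|w p.1| - |v (p.1 - p.2)|)), mul_nonneg (abs_nonneg (ρ p.2))
      (sq_nonneg (|w p.1| + |v (p.1 - p.2)|))]
  calc ∫ x, w x * (v ⋆[mul ℝ ℝ] ρ) x = ∫ x, ∫ y, w x * (ρ y * v (x - y)) := by
        simp_rw [convolution_mul_swap_apply, integral_const_mul]
    _ = ∫ y, ∫ x, w x * (ρ y * v (x - y)) := integral_integral_swap hint
    _ = _ := by
        refine integral_congr_ae (Filter.Eventually.of_forall fun y => ?_)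
        dsimp only
        rw [← integral_const_mul]
        simp_rw [mul_left_comm]

theorem inner_toLp (u : L2 d) {ψ : Rd → ℝ} (hψ : MemLp ψ 2 volume) :
    inner ℝ u (hψ.toLp ψ) = ∫ x, u x * ψ x := by
  rw [MeasureTheory.L2.inner_def]
  refine integral_congr_ae ?_
  filter_upwards [hψ.coeFn_toLp] with x hx
  simp [hx, mul_comm]

theorem L2.inner_eq (u v : L2 d) : inner ℝ u v = ∫ x, u x * v x := by
  rw [← inner_toLp u (Lp.memLp v), Lp.toLp_coeFn]

/-- Translations act continuously on `L²`. -/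
theorem continuous_integral_mul_comp_sub {w v : Rd → ℝ} (hw : MemLp w 2 volume)
    (hv : MemLp v 2 volume) : Continuous fun y => ∫ x, w x * v (x - y) := by
  have h1 : Continuous fun y : Rd =>
      inner ℝ (hw.toLp w) ((DomAddAct.mk (-y) : Rdᵈᵃᵃ) +ᵥ hv.toLp v) := by
    have : Fact ((2 : ENNReal) ≠ ⊤) := ⟨by simp⟩
    have h2 : Continuous fun y : Rd => (DomAddAct.mk (-y) : Rdᵈᵃᵃ) :=
      DomAddAct.continuous_mk.comp continuous_neg
    exact continuous_const.inner
      (continuous_vadd.comp (h2.prodMk (continuous_const (y := hv.toLp v))))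
  refine h1.congr fun y => ?_
  rw [DomAddAct.mk_vadd_toLp, inner_toLp]
  refine integral_congr_ae ?_
  filter_upwards [hw.coeFn_toLp] with x hx
  rw [hx, vadd_eq_add, neg_add_eq_sub]

theorem memLp_mul_of_bound {f : Rd → ℝ} (hf : AEStronglyMeasurable f) {C : ℝ}
    (hC : ∀ x, |f x| ≤ C) {u : Rd → ℝ} (hu : MemLp u 2 volume) :
    MemLp (fun x => f x * u x) 2 volume :=
  hu.of_le_mul (hf.mul hu.1) (c := C) (Filter.Eventually.of_forall fun x => by
    rw [norm_mul]
    exact mul_le_mul_of_nonneg_right (hC x) (norm_nonneg _))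

end TestFunctions

/-! ### Density of test functions in `H¹` -/

section Density

open Filter Topology

variable {d : ℕ}

local notation "Rd" => EuclideanSpace ℝ (Fin d)

/-- A vector field `(u, g)` that annihilates all `(φ, ∇φ)`, for test functions `φ`, annihilates
`(v, ∇v)` for all `v` in `H¹` of compact support. -/
theorem integral_eq_zero_of_compactSupport {u : L2 d} {g : Fin d → L2 d}
    (h : ∀ φ : Rd → ℝ, IsTest φ → (∫ x, u x * φ x) + ∑ i, ∫ x, g i x * pderiv i φ x = 0)
    {v : Rd → ℝ} (hv : MemLp v 2 volume) (hv' : HasCompactSupport v) {q : Fin d → Rd → ℝ}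
    (hq : ∀ i, MemLp (q i) 2 volume)
    (hvq : ∀ i, ∀ ψ : Rd → ℝ, IsTest ψ → ∫ x, v x * pderiv i ψ x = -∫ x, q i x * ψ x) :
    (∫ x, u x * v x) + ∑ i, ∫ x, g i x * q i x = 0 := by
  have hloc : LocallyIntegrable v := hv.locallyIntegrable (by norm_num)
  let K₀ : Rd → ℝ := fun y => ∫ x, u x * v (x - y)
  let K : Fin d → Rd → ℝ := fun i y => ∫ x, g i x * q i (x - y)
  have hK₀ : Continuous K₀ := continuous_integral_mul_comp_sub (Lp.memLp u) hv
  have hK : ∀ i, Continuous (K i) := fun i =>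
    continuous_integral_mul_comp_sub (Lp.memLp (g i)) (hq i)
  have hsum : Continuous fun y => K₀ y + ∑ i, K i y :=
    hK₀.add (continuous_finsetSum _ fun i _ => hK i)
  -- Since `v ⋆ ρ` is a test function, the hypothesis says that the summed correlations integrate to
  -- zero against every `ρ`. Being continuous, they vanish everywhere, and `y = 0` is the claim; no
  -- approximate identity is needed.
  have hae : ∀ᵐ y, K₀ y + ∑ i, K i y = 0 := by
    refine ae_eq_zero_of_integral_contDiff_smul_eq_zero hsum.locallyIntegrable
      fun ρ hρ hρ' => ?_
    have hρt : IsTest ρ := ⟨hρ, hρ'⟩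
    have hint : ∀ F : Rd → ℝ, Continuous F → Integrable fun y => ρ y * F y := fun F hF =>
      (hρt.continuous.mul hF).integrable_of_hasCompactSupport hρ'.mul_right
    have h1 := h _ (isTest_convolution hloc hv' hρt)
    simp only [pderiv_convolution_of_weak hloc (hvq _) hρt] at h1
    rw [integral_mul_convolution (Lp.memLp u) hv hρt] at h1
    simp only [integral_mul_convolution (Lp.memLp (g _)) (hq _) hρt] at h1
    simp only [smul_eq_mul, mul_add, Finset.mul_sum]
    rw [integral_add (hint _ hK₀) (integrable_finsetSum _ fun i _ => hint _ (hK i)),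
      integral_finsetSum _ fun i _ => hint _ (hK i)]
    exact h1
  have h0 : (fun y => K₀ y + ∑ i, K i y) = fun _ => 0 :=
    (Continuous.ae_eq_iff_eq volume hsum continuous_const).1 hae
  simpa [K₀, K] using congrFun h0 0

/-- The product rule for weak derivatives. -/
theorem integral_mul_pderiv_of_weak {u g : L2 d} {i : Fin d} (h : (u, g) ∈ weakPartialGraph i)
    {χ : Rd → ℝ} (hχ : IsTest χ) {ψ : Rd → ℝ} (hψ : IsTest ψ) :
    ∫ x, χ x * u x * pderiv i ψ x = -∫ x, (χ x * g x + pderiv i χ x * u x) * ψ x := by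
  have h1 := h _ (hχ.mul hψ)
  simp only [pderiv_mul hχ.differentiable hψ.differentiable] at h1
  have e1 : ∫ x, u x * (χ x * pderiv i ψ x + ψ x * pderiv i χ x) =
      (∫ x, χ x * u x * pderiv i ψ x) + ∫ x, pderiv i χ x * u x * ψ x := by
    rw [← integral_add]
    · exact integral_congr_ae (Eventually.of_forall fun x => by ring)
    · refine (L2.integrable_mul u (hχ.mul (hψ.pderiv i)).memLp).congr
        (Eventually.of_forall fun x => by dsimp only; ring)
    · refine (L2.integrable_mul u ((hχ.pderiv i).mul hψ).memLp).congr
        (Eventually.of_forall fun x => by dsimp only; ring)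
  have e2 : ∫ x, (χ x * g x + pderiv i χ x * u x) * ψ x =
      (∫ x, g x * (χ x * ψ x)) + ∫ x, pderiv i χ x * u x * ψ x := by
    rw [← integral_add]
    · exact integral_congr_ae (Eventually.of_forall fun x => by ring)
    · exact L2.integrable_mul g (hχ.mul hψ).memLp
    · refine (L2.integrable_mul u ((hχ.pderiv i).mul hψ).memLp).congr
        (Eventually.of_forall fun x => by dsimp only; ring)
  rw [e1] at h1
  rw [e2]
  linarith

/-- Smooth cut-off functions that exhaust the space, with derivatives tending to zero. -/
theorem exists_cutoff : ∃ (χ : ℕ → Rd → ℝ) (C : ℝ), (∀ n, IsTest (χ n)) ∧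
    (∀ n x, |χ n x| ≤ 1) ∧ (∀ x, Tendsto (fun n => χ n x) atTop (𝓝 1)) ∧
    ∀ n i x, |pderiv i (χ n) x| ≤ C / (n + 1) := by
  let f : ContDiffBump (0 : Rd) := ⟨1, 2, one_pos, one_lt_two⟩
  have hf : IsTest (f : Rd → ℝ) := ⟨f.contDiff, f.hasCompactSupport⟩
  obtain ⟨C, hC⟩ := (hf.2.fderiv ℝ).exists_bound_of_continuous
    (hf.1.continuous_fderiv (by simp))
  have hne : ∀ n : ℕ, ((n : ℝ) + 1)⁻¹ ≠ 0 := fun n => by positivity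
  refine ⟨fun n x => f (((n : ℝ) + 1)⁻¹ • x), C, fun n => ⟨?_, ?_⟩, fun n x => ?_, fun x => ?_,
    fun n i x => ?_⟩
  · exact hf.1.comp (contDiff_const_smul _)
  · exact hf.2.comp_homeomorph (Homeomorph.smulOfNeZero _ (hne n))
  · rw [abs_of_nonneg f.nonneg]
    exact f.le_one
  · have h1 : Tendsto (fun n : ℕ => ((n : ℝ) + 1)⁻¹ • x) atTop (𝓝 0) := by
      simpa using (tendsto_one_div_add_atTop_nhds_zero_nat (𝕜 := ℝ)).smul_const x
    have h2 := (f.continuous.tendsto 0).comp h1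
    rwa [f.one_of_mem_closedBall (by simp [f])] at h2
  · have h1 : HasFDerivAt (fun x => f (((n : ℝ) + 1)⁻¹ • x))
        (((n : ℝ) + 1)⁻¹ • fderiv ℝ f (((n : ℝ) + 1)⁻¹ • x)) x := by
      refine ((hf.differentiable _).hasFDerivAt.comp x
        ((hasFDerivAt_id x).const_smul ((n : ℝ) + 1)⁻¹)).congr_fderiv ?_
      ext v
      simp
    rw [pderiv, h1.fderiv, _root_.smul_apply, smul_eq_mul, abs_mul,
      abs_of_pos (by positivity), div_eq_inv_mul]
    refine mul_le_mul_of_nonneg_left ?_ (by positivity)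
    refine ((fderiv ℝ f (((n : ℝ) + 1)⁻¹ • x)).le_opNorm _).trans ?_
    simpa using hC (((n : ℝ) + 1)⁻¹ • x)

theorem tendsto_integral_cutoff {χ : ℕ → Rd → ℝ} (hχ : ∀ n, Continuous (χ n))
    (hχ1 : ∀ n x, |χ n x| ≤ 1) (hlim : ∀ x, Tendsto (fun n => χ n x) atTop (𝓝 1)) (u : L2 d) :
    Tendsto (fun n => ∫ x, u x * (χ n x * u x)) atTop (𝓝 (‖u‖ ^ 2)) := by
  rw [← real_inner_self_eq_norm_sq, L2.inner_eq]
  have hu := (Lp.memLp u).1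
  refine tendsto_integral_of_dominated_convergence (fun x => u x ^ 2)
    (fun n => hu.mul ((hχ n).aestronglyMeasurable.mul hu)) (Lp.memLp u).integrable_sq
    (fun n => Eventually.of_forall fun x => ?_) (Eventually.of_forall fun x => ?_)
  · rw [Real.norm_eq_abs, abs_mul, abs_mul, ← sq_abs]
    nlinarith [mul_le_mul_of_nonneg_left (hχ1 n x) (sq_nonneg |u x|)]
  · simpa using ((hlim x).mul_const (u x)).const_mul (u x)

/-- The pairs `(φ, ∇φ)`, for test functions `φ`, are total in `H¹(ℝᵈ)`. -/
theorem eq_zero_of_orthogonal_test {u : L2 d} {g : Fin d → L2 d}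
    (hug : ∀ i, (u, g i) ∈ weakPartialGraph i)
    (h : ∀ φ : Rd → ℝ, IsTest φ → (∫ x, u x * φ x) + ∑ i, ∫ x, g i x * pderiv i φ x = 0) :
    u = 0 ∧ ∀ i, g i = 0 := by
  obtain ⟨χ, C, hχ, hχ1, hlim, hder⟩ := exists_cutoff (d := d)
  have hmul : ∀ {ψ : Rd → ℝ}, IsTest ψ → ∀ f : L2 d, MemLp (fun x => ψ x * f x) 2 volume :=
    fun {ψ} hψ f => by
      obtain ⟨B, -, hB⟩ := hψ.exists_bound
      exact memLp_mul_of_bound hψ.continuous.aestronglyMeasurable hB (Lp.memLp f)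
  -- Take `v = χₙ u`: the main terms tend to `‖u‖² + ∑ ‖gᵢ‖²`, and the terms with `∂ᵢχₙ` are
  -- `O(1/n)`.
  have hzero : ∀ n, (∫ x, u x * (χ n x * u x)) + ∑ i, ((∫ x, g i x * (χ n x * g i x)) +
      ∫ x, g i x * (pderiv i (χ n) x * u x)) = 0 := fun n => by
    have h1 := integral_eq_zero_of_compactSupport h (hmul (hχ n) u) (hχ n).2.mul_right
      (q := fun i x => χ n x * g i x + pderiv i (χ n) x * u x)
      (fun i => (hmul (hχ n) (g i)).add (hmul ((hχ n).pderiv i) u))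
      (fun i ψ hψ => integral_mul_pderiv_of_weak (hug i) (hχ n) hψ)
    rw [← h1]
    congr 1
    refine Finset.sum_congr rfl fun i _ => ?_
    rw [← integral_add (L2.integrable_mul _ (hmul (hχ n) _))
      (L2.integrable_mul _ (hmul ((hχ n).pderiv i) u))]
    exact integral_congr_ae (Eventually.of_forall fun x => by ring)
  have herr : ∀ i, Tendsto (fun n => ∫ x, g i x * (pderiv i (χ n) x * u x)) atTop (𝓝 0) := by
    intro i
    have hint : Integrable fun x => |g i x * u x| :=
      (L2.integrable_mul (g i) (Lp.memLp u)).abs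
    have hb : Tendsto (fun n : ℕ => C / ((n : ℝ) + 1) * ∫ x, |g i x * u x|) atTop (𝓝 0) := by
      have := (tendsto_one_div_add_atTop_nhds_zero_nat (𝕜 := ℝ)).const_mul
        (C * ∫ x, |g i x * u x|)
      rw [mul_zero] at this
      exact this.congr fun n => by ring
    refine squeeze_zero_norm (fun n => ?_) hb
    rw [← integral_const_mul]
    refine norm_integral_le_of_norm_le (hint.const_mul _) (Eventually.of_forall fun x => ?_)
    rw [Real.norm_eq_abs, mul_left_comm, abs_mul]
    exact mul_le_mul_of_nonneg_right (hder n i x) (abs_nonneg _)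
  have hc := tendsto_integral_cutoff (fun n => (hχ n).continuous) hχ1 hlim
  have htot := (hc u).add (tendsto_finsetSum Finset.univ fun i _ => (hc (g i)).add (herr i))
  simp only [hzero, add_zero] at htot
  have h0 : ‖u‖ ^ 2 + ∑ i, ‖g i‖ ^ 2 = 0 := tendsto_nhds_unique htot tendsto_const_nhds
  have hs : 0 ≤ ∑ i, ‖g i‖ ^ 2 := Finset.sum_nonneg fun i _ => sq_nonneg _
  have hu0 : ‖u‖ ^ 2 = 0 := by nlinarith [sq_nonneg ‖u‖]
  have hg0 : ∑ i, ‖g i‖ ^ 2 = 0 := by linarith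
  rw [Finset.sum_eq_zero_iff_of_nonneg fun i _ => sq_nonneg _] at hg0
  exact ⟨by simpa using hu0, fun i => by simpa using hg0 i (Finset.mem_univ i)⟩

end Density

/-! ### `H¹` as a Hilbert space -/

section SobolevSpace

variable {d : ℕ}

local notation "Rd" => EuclideanSpace ℝ (Fin d)

/-- The Hilbert sum of `1 + d` copies of `L²(ℝᵈ)`, of which `H¹(ℝᵈ)` is a closed subspace. -/
abbrev L2Jet (d : ℕ) : Type := PiLp 2 fun _ : Option (Fin d) => L2 d

/-- The Sobolev space `H¹(ℝᵈ)`, as the space of all `(u, ∇u)`. -/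
def sobolevH1 (d : ℕ) : Submodule ℝ (L2Jet d) where
  carrier := {w | ∀ i, (w none, w (some i)) ∈ weakPartialGraph i}
  zero_mem' i := (weakPartialGraph i).zero_mem
  add_mem' hv hw i := (weakPartialGraph i).add_mem (hv i) (hw i)
  smul_mem' c _ hw i := (weakPartialGraph i).smul_mem c (hw i)

/-- Each test function imposes an equality of continuous functionals. Completeness is what Riesz and
Lax–Milgram require. -/
theorem isClosed_sobolevH1 : IsClosed (sobolevH1 d : Set (L2Jet d)) := by
  have h : (sobolevH1 d : Set (L2Jet d)) = ⋂ (i : Fin d) (φ : Rd → ℝ) (hφ : IsTest φ),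
      {w | inner ℝ (w none) ((hφ.memLp_pderiv i).toLp _) =
        -inner ℝ (w (some i)) (hφ.memLp.toLp _)} := by
    ext w
    simp only [mem_iInter, mem_ofPred_eq, inner_toLp]
    rfl
  rw [h]
  refine isClosed_iInter fun i => isClosed_iInter fun φ => isClosed_iInter fun hφ => ?_
  exact isClosed_eq ((PiLp.continuous_apply 2 _ none).inner continuous_const)
    ((PiLp.continuous_apply 2 _ (some i)).inner continuous_const).neg

instance : CompleteSpace (sobolevH1 d) := isClosed_sobolevH1.completeSpace_coe

/-- The element of `H¹(ℝᵈ)` given by a test function. -/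
def IsTest.toH1 {φ : Rd → ℝ} (h : IsTest φ) : sobolevH1 d :=
  ⟨WithLp.toLp 2 fun o => Option.casesOn o (h.memLp.toLp φ) fun i => (h.memLp_pderiv i).toLp _,
    fun i ψ hψ => by
      have h1 := h.integral_mul_pderiv hψ i
      refine Eq.trans (integral_congr_ae ?_) (h1.trans (congrArg Neg.neg (integral_congr_ae ?_)))
      · filter_upwards [h.memLp.coeFn_toLp] with x hx
        rw [← hx]
      · filter_upwards [(h.memLp_pderiv i).coeFn_toLp] with x hx
        rw [← hx]⟩

theorem IsTest.toH1_none {φ : Rd → ℝ} (h : IsTest φ) : h.toH1.1 none = h.memLp.toLp φ := rfl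

theorem IsTest.toH1_some {φ : Rd → ℝ} (h : IsTest φ) (i : Fin d) :
    h.toH1.1 (some i) = (h.memLp_pderiv i).toLp _ := rfl

/-- Test functions are dense in `H¹(ℝᵈ)`, as uniqueness of continuous functionals. -/
theorem sobolevH1_functional_eq_zero (L : sobolevH1 d →L[ℝ] ℝ)
    (h : ∀ (φ : Rd → ℝ) (hφ : IsTest φ), L hφ.toH1 = 0) : L = 0 := by
  have hL : ∀ v, inner ℝ ((InnerProductSpace.toDual ℝ (sobolevH1 d)).symm L) v = L v :=
    fun v => InnerProductSpace.toDual_symm_apply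
  -- The Riesz representative is itself a pair `(u, ∇u)`, and it is orthogonal to all test
  -- functions.
  set z := (InnerProductSpace.toDual ℝ (sobolevH1 d)).symm L
  obtain ⟨h0, h1⟩ := eq_zero_of_orthogonal_test z.2 fun φ hφ => by
    have h2 := h φ hφ
    rw [← hL, Submodule.coe_inner, PiLp.inner_apply, Fintype.sum_option, hφ.toH1_none,
      inner_toLp] at h2
    simpa only [hφ.toH1_some, inner_toLp] using h2
  have hz : z = 0 := Subtype.ext (PiLp.ext fun o => by
    cases o with
    | none => exact h0
    | some i => exact h1 i)
  ext v
  rw [← hL, hz, inner_zero_left]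
  rfl

/-- Multiplication by a bounded measurable function, on `L²(ℝᵈ)`. -/
def mulL2 {f : Rd → ℝ} (hf : AEStronglyMeasurable f) {C : ℝ} (hC : ∀ x, |f x| ≤ C) :
    L2 d →L[ℝ] L2 d :=
  LinearMap.mkContinuous
    { toFun := fun u => (memLp_mul_of_bound hf hC (Lp.memLp u)).toLp _
      map_add' := fun u v => by
        rw [← MemLp.toLp_add, MemLp.toLp_eq_toLp_iff]
        filter_upwards [Lp.coeFn_add u v] with x hx
        simp only [hx, Pi.add_apply, mul_add]
      map_smul' := fun c u => by
        rw [RingHom.id_apply, ← MemLp.toLp_const_smul, MemLp.toLp_eq_toLp_iff]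
        filter_upwards [Lp.coeFn_smul c u] with x hx
        simp only [hx, Pi.smul_apply, smul_eq_mul, mul_left_comm] } C fun u => by
    refine Lp.norm_le_mul_norm_of_ae_le_mul ?_
    filter_upwards [(memLp_mul_of_bound hf hC (Lp.memLp u)).coeFn_toLp] with x hx
    change ‖((memLp_mul_of_bound hf hC (Lp.memLp u)).toLp _ : L2 d) x‖ ≤ _
    rw [hx, norm_mul]
    exact mul_le_mul_of_nonneg_right (hC x) (norm_nonneg _)

theorem coeFn_mulL2 {f : Rd → ℝ} (hf : AEStronglyMeasurable f) {C : ℝ} (hC : ∀ x, |f x| ≤ C)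
    (u : L2 d) : mulL2 hf hC u =ᵐ[volume] fun x => f x * u x :=
  (memLp_mul_of_bound hf hC (Lp.memLp u)).coeFn_toLp

end SobolevSpace

/-! ### The elliptic form and maximal dissipativity -/

namespace DiffusionMatrix

variable {d : ℕ} (a : DiffusionMatrix d)

local notation "Rd" => EuclideanSpace ℝ (Fin d)

/-- Multiplication by the entry `a_ij`. -/
def entry (i j : Fin d) : L2 d →L[ℝ] L2 d :=
  mulL2 (a.measurable i j).aestronglyMeasurable fun x => a.bounded.choose_spec x i j

theorem inner_entry (i j : Fin d) (u v : L2 d) :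
    inner ℝ (a.entry i j u) v = ∫ x, a.coeff x i j * u x * v x := by
  rw [L2.inner_eq]
  refine integral_congr_ae ?_
  filter_upwards [coeFn_mulL2 (a.measurable i j).aestronglyMeasurable
    (fun x => a.bounded.choose_spec x i j) u] with x hx
  rw [entry, hx]

/-- The bilinear form `∑ᵢⱼ ∫ a_ij D_j u D_i v` on `H¹(ℝᵈ)`. -/
def form : sobolevH1 d →L[ℝ] sobolevH1 d →L[ℝ] ℝ :=
  ∑ i, ∑ j, (innerSL ℝ).bilinearComp
    (a.entry i j ∘L PiLp.proj 2 (fun _ : Option (Fin d) => L2 d) (some j) ∘L (sobolevH1 d).subtypeL)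
    (PiLp.proj 2 (fun _ : Option (Fin d) => L2 d) (some i) ∘L (sobolevH1 d).subtypeL)

theorem form_apply (u v : sobolevH1 d) :
    a.form u v = ∑ i, ∑ j, inner ℝ (a.entry i j (u.1 (some j))) (v.1 (some i)) := by
  simp only [form, sum_apply]
  rfl

theorem form_test (u : sobolevH1 d) {φ : Rd → ℝ} (hφ : IsTest φ) :
    a.form u hφ.toH1 = -a.divDistrib (fun j => u.1 (some j)) φ := by
  rw [form_apply, divDistrib, neg_neg]
  refine Finset.sum_congr rfl fun i _ => Finset.sum_congr rfl fun j _ => ?_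
  rw [hφ.toH1_some, inner_entry]
  refine integral_congr_ae ?_
  filter_upwards [(hφ.memLp_pderiv i).coeFn_toLp] with x hx
  rw [hx]

theorem form_self_ge {l : ℝ}
    (hl : ∀ x ξ : Rd, l * ‖ξ‖ ^ 2 ≤ ∑ i, ∑ j, ξ i * a.coeff x i j * ξ j) (u : sobolevH1 d) :
    l * ∑ i, ‖u.1 (some i)‖ ^ 2 ≤ a.form u u := by
  have hint : ∀ i j, Integrable fun x => a.coeff x i j * u.1 (some j) x * u.1 (some i) x :=
    fun i j => a.integrable _ (Lp.memLp _) i j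
  have hint' : ∀ i, Integrable fun x => u.1 (some i) x * u.1 (some i) x :=
    fun i => L2.integrable_mul _ (Lp.memLp _)
  simp only [form_apply, inner_entry]
  simp only [← real_inner_self_eq_norm_sq, L2.inner_eq]
  simp_rw [← integral_finsetSum _ fun j _ => hint _ j]
  rw [← integral_finsetSum _ fun i _ => integrable_finsetSum _ fun j _ => hint i j,
    ← integral_finsetSum _ fun i _ => hint' i, ← integral_const_mul]
  refine integral_mono ((integrable_finsetSum _ fun i _ => hint' i).const_mul l)
    (integrable_finsetSum _ fun i _ => integrable_finsetSum _ fun j _ => hint i j) fun x => ?_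
  -- Ellipticity at the point `x`, with `ξ = ∇u(x)`.
  have h := hl x (WithLp.toLp 2 fun i => u.1 (some i) x)
  rw [EuclideanSpace.real_norm_sq_eq] at h
  simp only [pow_two] at h
  refine h.trans_eq (Finset.sum_congr rfl fun i _ => Finset.sum_congr rfl fun j _ => ?_)
  ring

/-- By density the distributional equation extends to all `v` in `H¹`; this admits `v = u` and
matches what Lax–Milgram delivers. -/
theorem mem_opGraph_iff (u f : L2 d) :
    (u, f) ∈ a.opGraph ↔ ∃ w : sobolevH1 d, w.1 none = u ∧
      ∀ v : sobolevH1 d, a.form w v = -inner ℝ f (v.1 none) := by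
  constructor
  · rintro ⟨g, hg, hf⟩
    let w : sobolevH1 d := ⟨WithLp.toLp 2 fun o => Option.casesOn (motive := fun _ => L2 d) o u g, fun i => hg i⟩
    refine ⟨w, rfl, fun v => ?_⟩
    have h := sobolevH1_functional_eq_zero (a.form w + (innerSL ℝ f) ∘L
      PiLp.proj 2 (fun _ : Option (Fin d) => L2 d) none ∘L (sobolevH1 d).subtypeL) fun φ hφ => by
        change a.form w hφ.toH1 + inner ℝ f (hφ.toH1.1 none) = 0
        rw [form_test, hφ.toH1_none, inner_toLp, ← hf φ hφ]
        exact neg_add_cancel _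
    have h' : a.form w v + inner ℝ f (v.1 none) = 0 := DFunLike.congr_fun h v
    linarith
  · rintro ⟨w, rfl, hw⟩
    refine ⟨fun j => w.1 (some j), w.2, fun φ hφ => ?_⟩
    have h := hw hφ.toH1
    rw [form_test, hφ.toH1_none, inner_toLp] at h
    exact neg_injective h

theorem op_isMaxDissipative (hE : a.UniformlyElliptic) : a.op.IsMaxDissipative := by
  obtain ⟨l, hl, hl'⟩ := hE
  refine ⟨fun x => ?_, fun ν hν f => ?_⟩
  · have hx : ((x : L2 d), a.op x) ∈ a.opGraph := by
      rw [← op_graph]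
      exact a.op.mem_graph x
    obtain ⟨w, hw, hw'⟩ := (a.mem_opGraph_iff _ _).1 hx
    have h1 := hw' w
    have h2 := a.form_self_ge hl' w
    have h3 : 0 ≤ l * ∑ i, ‖w.1 (some i)‖ ^ 2 :=
      mul_nonneg hl.le (Finset.sum_nonneg fun i _ => sq_nonneg _)
    rw [hw] at h1
    linarith
  · let P : sobolevH1 d →L[ℝ] L2 d :=
      PiLp.proj 2 (fun _ : Option (Fin d) => L2 d) none ∘L (sobolevH1 d).subtypeL
    have hP : ∀ v, P v = v.1 none := fun v => rfl
    let B : sobolevH1 d →L[ℝ] sobolevH1 d →L[ℝ] ℝ :=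
      ν • ((innerSL ℝ).bilinearComp P P : sobolevH1 d →L[ℝ] sobolevH1 d →L[ℝ] ℝ) + a.form
    have hB : ∀ v w, B v w = ν * inner ℝ (P v) (P w) + a.form v w := fun v w => rfl
    -- The zeroth-order term controls `‖v‖²` with constant `ν`, the form controls `‖∇v‖²` with
    -- constant `l`.
    have hcoer : IsCoercive B := by
      refine ⟨min ν l, lt_min hν hl, fun v => ?_⟩
      have h1 := a.form_self_ge hl' v
      have h2 : ‖v‖ * ‖v‖ = ‖P v‖ ^ 2 + ∑ i, ‖v.1 (some i)‖ ^ 2 := by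
        rw [← pow_two, Submodule.coe_norm, PiLp.norm_sq_eq_of_L2, Fintype.sum_option, hP]
      have h3 : 0 ≤ ∑ i, ‖v.1 (some i)‖ ^ 2 := Finset.sum_nonneg fun i _ => sq_nonneg _
      rw [mul_assoc, h2, hB, real_inner_self_eq_norm_sq, mul_add]
      exact add_le_add (mul_le_mul_of_nonneg_right (min_le_left _ _) (sq_nonneg _))
        ((mul_le_mul_of_nonneg_right (min_le_right _ _) h3).trans h1)
    let w := hcoer.continuousLinearEquivOfBilin.symm
      ((InnerProductSpace.toDual ℝ (sobolevH1 d)).symm (innerSL ℝ f ∘L P))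
    have hw : ∀ v, B w v = inner ℝ f (P v) := fun v => by
      rw [← hcoer.continuousLinearEquivOfBilin_apply, ContinuousLinearEquiv.apply_symm_apply,
        InnerProductSpace.toDual_symm_apply]
      rfl
    -- The variational equation reads `form w v = -⟨ν w - f, v⟩`, that is, `A w = ν w - f`.
    have hmem : (P w, ν • P w - f) ∈ a.opGraph := (a.mem_opGraph_iff _ _).2 ⟨w, rfl, fun v => by
      have h := hw v
      rw [hB] at h
      rw [← hP v, inner_sub_left, real_inner_smul_left]
      linarith⟩
    rw [← op_graph, LinearPMap.mem_graph_iff] at hmem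
    obtain ⟨x, hx, hx'⟩ := hmem
    exact ⟨x, by rw [hx', hx, sub_sub_cancel]⟩

end DiffusionMatrix

end

theorem proposition3p14 (d : ℕ) (a : DiffusionMatrix d) (hE : a.UniformlyElliptic)
    (T : ℝ) (hT : 0 < T) (u₀ : L2 d) (hu₀ : u₀ ∈ a.op.domain) :
    ∃ u : ℝ → L2 d,
      a.op.IsStrongSolution T u₀ u ∧
      (∀ v : ℝ → L2 d, a.op.IsStrongSolution T u₀ v → Set.EqOn v u (Set.Icc 0 T)) ∧
      ∀ k : ℕ, 2 ≤ k → u₀ ∈ a.op.powDomain k →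
        ∀ j : ℕ, j ≤ k → a.op.MemCPowDom T (k - j) j u := by
  obtain ⟨u, h1, h2, h3⟩ := (a.op_isMaxDissipative hE).exists_isStrongSolution hT hu₀
  exact ⟨u, h1, h2, fun k _ hk => h3 k hk⟩
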